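/- **Setting.** Fix integers $m,\ell,n\ge 0$, real channel coefficients $h_0,\dots,h_\ell$ (put $h_i=0$ for other $i$), and time instants $t_1,\dots,t_n\in\mathbb Z$. Let $(A_t)_{t\in\mathbb Z}$ be random symbols with values in $\{-1,1\}$ and arbitrary joint distribution, and let $(W_t)_{t\in\mathbb Z}$ be a zero-mean jointly Gaussian noise process, independent of $(A_t)$ and with arbitrary covariance (it may be correlated, non-stationary, degenerate). The channel output is $Z_t=\sum_{i=0}^{\ell}h_iA_{t-i}-W_t$. Write $$\mathbf A_t=[A_{t-m-\ell},\dots,A_{t+m+\ell}]^T,\quad \mathbf Z_t=[Z_{t-m},\dots,Z_{t+m+\ell}]^T,\quad \mathbf W_t=[W_{t-m},\dots,W_{t+m+\ell}]^T .$$ Number the rows of the following matrices by $k=0,\dots,2m+\ell$ and their columns by $p=0,\dots,2(m+\ell)$. Both $\mathbf H$ and $\mathbf T$ have size $(2m+\ell+1)\times(2(m+\ell)+1)$; $\mathbf H$ has the entries $h_{k+\ell-p}$ in the middle columns $\ell\le p\le \ell+2m$ and $0$ elsewhere; $\mathbf T$ has the entries $h_{k+\ell-p}$ in the first $\ell$ and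 the last $\ell$ columns and $0$ elsewhere. (Thus $\mathbf Z_t=(\mathbf H+\mathbf T)\mathbf A_t-\mathbf W_t$.) Let $\mathbf h_0=[0,\dots,0,h_0,\dots,h_\ell,0,\dots,0]^T$ with $m$ zeros on each side. Sequences $\mathbf a$ of length $2(m+\ell)+1$ are indexed as $a_{-(m+\ell)},\dots,a_{m+\ell}$; let $\mathcal M$ be the set of those in $\{-1,1\}^{2(m+\ell)+1}$ with $a_i=1$ for all $|i|>m$. With $\mathbf 1$ the all-ones vector and $|\cdot|$ the Euclidean norm put $$\Delta_t(\mathbf a,\bar{\mathbf a})=|\mathbf Z_t-\mathbf T\mathbf 1-\mathbf H\mathbf a|^2-|\mathbf Z_t-\mathbf T\mathbf 1-\mathbf H\bar{\mathbf a}|^2,$$ $$X_t=\max_{\mathbf a\in\mathcal M,\ a_0\ne A_t}\tfrac14\Delta_t(\mathbf A_t,\mathbf a),\qquad Y_t=\max_{\mathbf a\in\mathcal M,\ a_0= A_t}\tfrac14\Delta_t(\mathbf A_t,\mathbf a).$$ **Matrices.** Let $\mathbf E=[\mathbf e_{-m},\dots,\mathbf e_{-1},\mathbf e_1,\dots,\mathbf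 e_m]$, where $\mathbf e_i$ is the unit vector of length $2(m+\ell)+1$ with its $1$ at index $i$; let $\mathbf S=[\mathbf s_0,\dots,\mathbf s_{2^{2m}-1}]$ have all binary vectors of length $2m$ as its columns; let $\mathbf G(\mathbf a)=\mathbf H\,\mathrm{diag}(\mathbf a)\,\mathbf E$. Write $\mathbf A=(\mathbf A_{t_1},\dots,\mathbf A_{t_n})$, let $\Gamma=\Gamma(\mathbf A)$ be the block diagonal matrix with blocks $\mathbf G(\mathbf A_{t_1}),\dots,\mathbf G(\mathbf A_{t_n})$, and let $K_W=\mathbb E\{\mathbf W\mathbf W^T\}$, where $\mathbf W$ is the concatenation of $\mathbf W_{t_1},\dots,\mathbf W_{t_n}$. Let $Q=Q(\mathbf A)$ and a diagonal matrix $\Lambda=\Lambda(\mathbf A)$, both of size $2mn\times 2mn$, be any functions of $\mathbf A$ that satisfy $$Q\Lambda^2Q^T=\Gamma^TK_W\Gamma,\qquad Q^T(I_n\otimes \mathbf S\mathbf S^T)Q=I,$$ and such that the number of positive diagonal elements of $\Lambda$ equals $\mathrm{rank}(\Gamma^TK_W\Gamma)$. Let $\Lambda^\dagger$ be obtained by reciprocating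 only the non-zero diagonal elements of $\Lambda$, let $Q_1,\dots,Q_n$ be the consecutive blocks of $2m$ rows of $Q$, let $D=\mathrm{diag}(A_{t_1},\dots,A_{t_n})\otimes\mathbf h_0^T$ and $$F=D\,K_W\,\Gamma\,(I_n\otimes\mathbf S\mathbf S^T)\,Q\,\Lambda^\dagger,\qquad K_V(\mathbf A)=DK_WD^T-FF^T .$$ For $\mathbf a=\mathbf A_t$ let $\mu(\mathbf a)$ and $\nu(\mathbf a)$ be the vectors with the components $$\mu_k=[\mathbf G(\mathbf a)\mathbf s_k]^T\mathbf T(\mathbf 1-\mathbf a)-|\mathbf G(\mathbf a)\mathbf s_k|^2,\qquad \nu_k=\mu_k-2a_0\,\mathbf h_0^T\mathbf G(\mathbf a)\mathbf s_k .$$ For $u\in\mathbb R^{2mn}$ and $1\le i\le n$ put, with $\max$ of a vector denoting its largest component, $$\delta_i(u,\mathbf A)=\max\big(\mathbf S^TQ_i\Lambda u+\mu(\mathbf A_{t_i})\big)-\max\big(\mathbf S^TQ_i\Lambda u+\nu(\mathbf A_{t_i})\big),$$ $$\eta_i(u,\mathbf A)=A_{t_i}[\mathbf T(\mathbf 1-\mathbf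 A_{t_i})]^T\mathbf h_0-|\mathbf h_0|^2+(Fu)_i .$$ Let $\Phi_K$ denote the distribution function of the zero-mean Gaussian vector with (possibly singular) covariance matrix $K$. **Theorem.** Such $Q,\Lambda$ exist for every realization of $\mathbf A$. For every such choice, $K_V(\mathbf A)$ is positive semidefinite, and for all $r\in\mathbb R^n$ $$\Pr\Big(\bigcap_{i=1}^n\{X_{t_i}-Y_{t_i}\le r_i\}\Big)=\mathbb E\Big\{\Phi_{K_V(\mathbf A)}\big(r+\delta(U,\mathbf A)-\eta(U,\mathbf A)\big)\Big\},$$ where $U$ is a standard (zero-mean, identity-covariance) Gaussian vector of length $2mn$, independent of $\mathbf A$. No rank condition is imposed on $\Gamma^TK_W\Gamma$. -/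

import Mathlib

open MeasureTheory ProbabilityTheory
open scoped Matrix Kronecker

noncomputable section

namespace MLM

/-- The channel coefficients `h_0, …, h_ℓ`, extended by zero to all integer indices. -/
def coef {ℓ : ℕ} (h : Fin (ℓ + 1) → ℝ) (i : ℤ) : ℝ :=
  ∑ j : Fin (ℓ + 1), if ((j : ℕ) : ℤ) = i then h j else 0

/-- The channel output `Z_t = ∑_{i=0}^ℓ h_i A_{t-i} - W_t`. -/
def channelOutput {Ω : Type*} {ℓ : ℕ} (h : Fin (ℓ + 1) → ℝ) (A W : ℤ → Ω → ℝ)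
    (t : ℤ) (ω : Ω) : ℝ :=
  ∑ i : Fin (ℓ + 1), h i * A (t - ((i : ℕ) : ℤ)) ω - W t ω

/-- The symbol neighborhood `[A_{t-m-ℓ}, …, A_{t+m+ℓ}]`. Position `p` carries the offset
`p - (m + ℓ)` from the central time `t`. -/
def symbolWindow {Ω : Type*} (m ℓ : ℕ) (A : ℤ → Ω → ℝ) (t : ℤ) (ω : Ω) :
    Fin (2 * (m + ℓ) + 1) → ℝ :=
  fun p => A (t - (m : ℤ) - (ℓ : ℤ) + ((p : ℕ) : ℤ)) ω

/-- The neighborhood `[V_{t-m}, …, V_{t+m+ℓ}]` of length `2m+ℓ+1`, used for the channel outputs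
and for the noise samples. -/
def outputWindow {Ω : Type*} (m ℓ : ℕ) (V : ℤ → Ω → ℝ) (t : ℤ) (ω : Ω) :
    Fin (2 * m + ℓ + 1) → ℝ :=
  fun k => V (t - (m : ℤ) + ((k : ℕ) : ℤ)) ω

/-- The position of the `0`-th component of a sequence of length `2(m+ℓ)+1` that is indexed by
the offsets `-(m+ℓ), …, m+ℓ`. -/
def center (m ℓ : ℕ) : Fin (2 * (m + ℓ) + 1) := ⟨m + ℓ, by omega⟩

/-- The vector `h_i = [0, …, 0, h_0, …, h_ℓ, 0, …, 0]` with `m+i` leading zeros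
(for `|i| ≤ m`). -/
def hVec (m : ℕ) {ℓ : ℕ} (h : Fin (ℓ + 1) → ℝ) (i : ℤ) : Fin (2 * m + ℓ + 1) → ℝ :=
  fun k => coef h (((k : ℕ) : ℤ) - ((m : ℤ) + i))

/-- `H = [0, …, 0, h_{-m}, …, h_m, 0, …, 0]` with `ℓ` zero columns on each side. -/
def Hmat (m : ℕ) {ℓ : ℕ} (h : Fin (ℓ + 1) → ℝ) :
    Matrix (Fin (2 * m + ℓ + 1)) (Fin (2 * (m + ℓ) + 1)) ℝ :=
  Matrix.of fun k p =>
    if ℓ ≤ (p : ℕ) ∧ (p : ℕ) ≤ ℓ + 2 * m then hVec m h (((p : ℕ) : ℤ) - (ℓ : ℤ) - (m : ℤ)) k else 0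

/-- `T = [T₁, 0, …, 0, T₂]`: the first `ℓ` columns and the last `ℓ` columns of the banded
Toeplitz matrix with entries `h_{k+ℓ-p}`, the middle `2m+1` columns being zero. -/
def Tmat (m : ℕ) {ℓ : ℕ} (h : Fin (ℓ + 1) → ℝ) :
    Matrix (Fin (2 * m + ℓ + 1)) (Fin (2 * (m + ℓ) + 1)) ℝ :=
  Matrix.of fun k p =>
    if ℓ ≤ (p : ℕ) ∧ (p : ℕ) ≤ ℓ + 2 * m then 0 else coef h (((k : ℕ) : ℤ) + (ℓ : ℤ) - ((p : ℕ) : ℤ))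

/-- The squared Euclidean norm `|v|²`. -/
def sqNorm {ι : Type*} [Fintype ι] (v : ι → ℝ) : ℝ := v ⬝ᵥ v

/-- The candidate sequences: `±1` sequences of length `2(m+ℓ)+1` that are equal to `1` at all
offsets `i` with `|i| > m`. -/
def candidates (m ℓ : ℕ) : Set (Fin (2 * (m + ℓ) + 1) → ℝ) :=
  {a | (∀ p, a p = -1 ∨ a p = 1) ∧
    ∀ p : Fin (2 * (m + ℓ) + 1), (m : ℤ) < |((p : ℕ) : ℤ) - ((m : ℤ) + (ℓ : ℤ))| → a p = 1}

/-- `Δ(a, a'; z) = |z - T𝟙 - H a|² - |z - T𝟙 - H a'|²`. -/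
def distDiff (m : ℕ) {ℓ : ℕ} (h : Fin (ℓ + 1) → ℝ) (z : Fin (2 * m + ℓ + 1) → ℝ)
    (a a' : Fin (2 * (m + ℓ) + 1) → ℝ) : ℝ :=
  sqNorm (z - Tmat m h *ᵥ 1 - Hmat m h *ᵥ a) - sqNorm (z - Tmat m h *ᵥ 1 - Hmat m h *ᵥ a')

/-- `X_t`: the maximum of `Δ(A_t, a) / 4` over the candidates `a` with `a_0 ≠ A_t`
(a finite nonempty set, so that the supremum is a maximum). -/
def Xvar {Ω : Type*} (m : ℕ) {ℓ : ℕ} (h : Fin (ℓ + 1) → ℝ) (A W : ℤ → Ω → ℝ)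
    (t : ℤ) (ω : Ω) : ℝ :=
  ⨆ a : {a : Fin (2 * (m + ℓ) + 1) → ℝ // a ∈ candidates m ℓ ∧ a (center m ℓ) ≠ A t ω},
    1 / 4 * distDiff m h (outputWindow m ℓ (channelOutput h A W) t ω) (symbolWindow m ℓ A t ω) a.1

/-- `Y_t`: the maximum of `Δ(A_t, a) / 4` over the candidates `a` with `a_0 = A_t`. -/
def Yvar {Ω : Type*} (m : ℕ) {ℓ : ℕ} (h : Fin (ℓ + 1) → ℝ) (A W : ℤ → Ω → ℝ)
    (t : ℤ) (ω : Ω) : ℝ :=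
  ⨆ a : {a : Fin (2 * (m + ℓ) + 1) → ℝ // a ∈ candidates m ℓ ∧ a (center m ℓ) = A t ω},
    1 / 4 * distDiff m h (outputWindow m ℓ (channelOutput h A W) t ω) (symbolWindow m ℓ A t ω) a.1

/-- The offsets `-m, …, -1, 1, …, m`, listed in increasing order. -/
def offset (m : ℕ) (j : Fin (2 * m)) : ℤ :=
  if (j : ℕ) < m then ((j : ℕ) : ℤ) - (m : ℤ) else ((j : ℕ) : ℤ) - (m : ℤ) + 1

/-- `E = [e_{-m}, …, e_{-1}, e_1, …, e_m]`, where `e_i` has a single `1`, at offset `i`. -/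
def Emat (m ℓ : ℕ) : Matrix (Fin (2 * (m + ℓ) + 1)) (Fin (2 * m)) ℝ :=
  Matrix.of fun p j => if ((p : ℕ) : ℤ) = (m : ℤ) + (ℓ : ℤ) + offset m j then 1 else 0

/-- `S`: its columns are all the binary vectors of length `2m`, each once. The columns are indexed
by the binary vectors themselves. -/
def Smat (m : ℕ) : Matrix (Fin (2 * m)) (Fin (2 * m) → Fin 2) ℝ :=
  Matrix.of fun j s => ((s j : ℕ) : ℝ)

/-- `G(a) = H diag(a) E`. -/
def Gmat (m : ℕ) {ℓ : ℕ} (h : Fin (ℓ + 1) → ℝ) (a : Fin (2 * (m + ℓ) + 1) → ℝ) :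
    Matrix (Fin (2 * m + ℓ + 1)) (Fin (2 * m)) ℝ :=
  Hmat m h * Matrix.diagonal a * Emat m ℓ

/-- The block diagonal matrix `Γ(a) = diag(G(a_1), …, G(a_n))`; the first component of an index
is the number of the block. -/
def Gamma (m : ℕ) {ℓ n : ℕ} (h : Fin (ℓ + 1) → ℝ) (a : Fin n → Fin (2 * (m + ℓ) + 1) → ℝ) :
    Matrix (Fin n × Fin (2 * m + ℓ + 1)) (Fin n × Fin (2 * m)) ℝ :=
  Matrix.of fun p q => if p.1 = q.1 then Gmat m h (a p.1) p.2 q.2 else 0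

/-- The covariance matrix `K_W = E{W W^T}` of the concatenation `W` of the noise neighborhoods
around the times `t_1, …, t_n`. -/
def noiseCov {Ω : Type*} [MeasurableSpace Ω] (P : Measure Ω) (m ℓ : ℕ) {n : ℕ}
    (W : ℤ → Ω → ℝ) (t : Fin n → ℤ) :
    Matrix (Fin n × Fin (2 * m + ℓ + 1)) (Fin n × Fin (2 * m + ℓ + 1)) ℝ :=
  Matrix.of fun p q =>
    ∫ ω, outputWindow m ℓ W (t p.1) ω p.2 * outputWindow m ℓ W (t q.1) ω q.2 ∂P

/-- The matrix `I_n ⊗ S S^T`. -/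
def kronSS (m n : ℕ) : Matrix (Fin n × Fin (2 * m)) (Fin n × Fin (2 * m)) ℝ :=
  (1 : Matrix (Fin n) (Fin n) ℝ) ⊗ₖ (Smat m * (Smat m)ᵀ)

/-- `Q` and `Λ = diag(d)` form an admissible pair for the covariance matrix `K` and the symbols
`a`: `Q Λ² Q^T = Γ(a)^T K Γ(a)`, the number of positive diagonal elements of `Λ` is the rank of
the right-hand side, and `Q^T (I_n ⊗ S S^T) Q = I`. -/
structure IsFactorization (m : ℕ) {ℓ n : ℕ} (h : Fin (ℓ + 1) → ℝ)
    (K : Matrix (Fin n × Fin (2 * m + ℓ + 1)) (Fin n × Fin (2 * m + ℓ + 1)) ℝ)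
    (a : Fin n → Fin (2 * (m + ℓ) + 1) → ℝ)
    (Q : Matrix (Fin n × Fin (2 * m)) (Fin n × Fin (2 * m)) ℝ)
    (d : Fin n × Fin (2 * m) → ℝ) : Prop where
  decomposes : Q * Matrix.diagonal d ^ 2 * Qᵀ = (Gamma m h a)ᵀ * K * Gamma m h a
  card_pos : {q | 0 < d q}.ncard = ((Gamma m h a)ᵀ * K * Gamma m h a).rank
  diagonalizes : Qᵀ * kronSS m n * Q = 1

/-- The `n` by `n(2m+ℓ+1)` matrix `diag(A_{t_1}, …, A_{t_n}) ⊗ h_0^T`, where `A_{t_i}` is the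
`0`-th component of `a_i`. -/
def diagKronH (m : ℕ) {ℓ n : ℕ} (h : Fin (ℓ + 1) → ℝ) (a : Fin n → Fin (2 * (m + ℓ) + 1) → ℝ) :
    Matrix (Fin n) (Fin n × Fin (2 * m + ℓ + 1)) ℝ :=
  Matrix.of fun i p => if i = p.1 then a i (center m ℓ) * hVec m h 0 p.2 else 0

/-- `F = (diag(A_{t_1}, …, A_{t_n}) ⊗ h_0^T) K Γ(a) (I_n ⊗ S S^T) Q Λ†` with `Λ = diag(d)`.
As `0⁻¹ = 0`, the diagonal matrix of the `(d q)⁻¹` reciprocates only the non-zero elements. -/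
def Fmat (m : ℕ) {ℓ n : ℕ} (h : Fin (ℓ + 1) → ℝ)
    (K : Matrix (Fin n × Fin (2 * m + ℓ + 1)) (Fin n × Fin (2 * m + ℓ + 1)) ℝ)
    (a : Fin n → Fin (2 * (m + ℓ) + 1) → ℝ)
    (Q : Matrix (Fin n × Fin (2 * m)) (Fin n × Fin (2 * m)) ℝ)
    (d : Fin n × Fin (2 * m) → ℝ) : Matrix (Fin n) (Fin n × Fin (2 * m)) ℝ :=
  diagKronH m h a * K * Gamma m h a * (kronSS m n * Q) * Matrix.diagonal (fun q => (d q)⁻¹)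

/-- `μ(a) = [G(a) S]^T T (𝟙 - a) - [|G(a) s|²]_s`, with one component for each column `s` of
`S`. -/
def muVec (m : ℕ) {ℓ : ℕ} (h : Fin (ℓ + 1) → ℝ) (a : Fin (2 * (m + ℓ) + 1) → ℝ) :
    (Fin (2 * m) → Fin 2) → ℝ :=
  (Gmat m h a * Smat m)ᵀ *ᵥ (Tmat m h *ᵥ (1 - a)) -
    fun s => sqNorm (Gmat m h a *ᵥ fun j => Smat m j s)

/-- `ν(a) = μ(a) - 2 a_0 h_0^T G(a) S`. -/
def nuVec (m : ℕ) {ℓ : ℕ} (h : Fin (ℓ + 1) → ℝ) (a : Fin (2 * (m + ℓ) + 1) → ℝ) :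
    (Fin (2 * m) → Fin 2) → ℝ :=
  muVec m h a - (2 * a (center m ℓ)) • (hVec m h 0 ᵥ* (Gmat m h a * Smat m))

/-- The largest component of a vector. -/
def vecMax {ι : Type*} [Fintype ι] [Nonempty ι] (v : ι → ℝ) : ℝ :=
  Finset.univ.sup' Finset.univ_nonempty v

/-- The `i`-th of the `n` blocks of `2m` rows of `Q`. -/
def Qblock {m n : ℕ} (Q : Matrix (Fin n × Fin (2 * m)) (Fin n × Fin (2 * m)) ℝ) (i : Fin n) :
    Matrix (Fin (2 * m)) (Fin n × Fin (2 * m)) ℝ :=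
  Matrix.of fun j q => Q (i, j) q

/-- `δ_i = max (S^T Q_i Λ u + μ(a_i)) - max (S^T Q_i Λ u + ν(a_i))`. -/
def deltaVec (m : ℕ) {ℓ n : ℕ} (h : Fin (ℓ + 1) → ℝ)
    (a : Fin n → Fin (2 * (m + ℓ) + 1) → ℝ)
    (Q : Matrix (Fin n × Fin (2 * m)) (Fin n × Fin (2 * m)) ℝ)
    (d : Fin n × Fin (2 * m) → ℝ) (u : Fin n × Fin (2 * m) → ℝ) : Fin n → ℝ :=
  fun i =>
    vecMax (((Smat m)ᵀ * Qblock Q i * Matrix.diagonal d) *ᵥ u + muVec m h (a i)) -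
      vecMax (((Smat m)ᵀ * Qblock Q i * Matrix.diagonal d) *ᵥ u + nuVec m h (a i))

/-- `η_i = A_{t_i} [T (𝟙 - a_i)]^T h_0 - |h_0|² + (F u)_i`, where `A_{t_i}` is the `0`-th
component of `a_i`. -/
def etaVec (m : ℕ) {ℓ n : ℕ} (h : Fin (ℓ + 1) → ℝ)
    (K : Matrix (Fin n × Fin (2 * m + ℓ + 1)) (Fin n × Fin (2 * m + ℓ + 1)) ℝ)
    (a : Fin n → Fin (2 * (m + ℓ) + 1) → ℝ)
    (Q : Matrix (Fin n × Fin (2 * m)) (Fin n × Fin (2 * m)) ℝ)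
    (d : Fin n × Fin (2 * m) → ℝ) (u : Fin n × Fin (2 * m) → ℝ) : Fin n → ℝ :=
  fun i =>
    a i (center m ℓ) * ((Tmat m h *ᵥ (1 - a i)) ⬝ᵥ hVec m h 0) - sqNorm (hVec m h 0) +
      (Fmat m h K a Q d *ᵥ u) i

/-- `K_V = D K D^T - F F^T` with `D = diag(A_{t_1}, …, A_{t_n}) ⊗ h_0^T`. -/
def KV (m : ℕ) {ℓ n : ℕ} (h : Fin (ℓ + 1) → ℝ)
    (K : Matrix (Fin n × Fin (2 * m + ℓ + 1)) (Fin n × Fin (2 * m + ℓ + 1)) ℝ)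
    (a : Fin n → Fin (2 * (m + ℓ) + 1) → ℝ)
    (Q : Matrix (Fin n × Fin (2 * m)) (Fin n × Fin (2 * m)) ℝ)
    (d : Fin n × Fin (2 * m) → ℝ) : Matrix (Fin n) (Fin n) ℝ :=
  diagKronH m h a * K * (diagKronH m h a)ᵀ - Fmat m h K a Q d * (Fmat m h K a Q d)ᵀ

/-- `Φ_K(r)`: the distribution function at `r` of the Gaussian vector with mean zero and
covariance matrix `K` (for positive semidefinite, possibly singular, `K`). -/
def gaussianCDF {n : ℕ} (K : Matrix (Fin n) (Fin n) ℝ) (r : Fin n → ℝ) : ℝ :=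
  (multivariateGaussian 0 K).real {x : EuclideanSpace ℝ (Fin n) | ∀ i, x i ≤ r i}

/-- The concatenation of the symbol neighborhoods around the times `t_1, …, t_n`. -/
def symbolBlock {Ω : Type*} (m ℓ : ℕ) {n : ℕ} (A : ℤ → Ω → ℝ) (t : Fin n → ℤ) (ω : Ω) :
    Fin n → Fin (2 * (m + ℓ) + 1) → ℝ :=
  fun i => symbolWindow m ℓ A (t i) ω

/-- `Φ_{K_V(a)}(r + δ(u, a) - η(u, a))`. -/
def integrand (m : ℕ) {ℓ n : ℕ} (h : Fin (ℓ + 1) → ℝ)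
    (K : Matrix (Fin n × Fin (2 * m + ℓ + 1)) (Fin n × Fin (2 * m + ℓ + 1)) ℝ)
    (a : Fin n → Fin (2 * (m + ℓ) + 1) → ℝ)
    (Q : Matrix (Fin n × Fin (2 * m)) (Fin n × Fin (2 * m)) ℝ)
    (d : Fin n × Fin (2 * m) → ℝ) (r : Fin n → ℝ) (u : Fin n × Fin (2 * m) → ℝ) : ℝ :=
  gaussianCDF (KV m h K a Q d) (r + deltaVec m h a Q d u - etaVec m h K a Q d u)

end MLM

end

/-! ### Positive definiteness of the Gram matrix `S Sᵀ`. -/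

namespace MLM

/-! Every candidate arises from `A_t` by flipping signs at the offsets selected by a binary vector
`s`, and possibly at offset 0; the values at the edges do not matter because `H` has zero columns
there. With `v = G s`, or `v = G s + a₀ h₀` if the central sign flips, expanding the squares gives
`Δ/4 = v·(W + T(1 - a)) - |v|²`. Hence `Y` and `X` are maxima over `s` of affine functions of `Gᵀ
W`, and `X` has in addition a summand linear in `h₀ᵀ W` that does not depend on `s` (`Yvar_eq`,
`Xvar_eq`).

For fixed symbols the event therefore involves the noise only through the Gaussian pair `(D W, Γᵀ
W)`. This pair has the law of `(F U + V, Q Λ U)`, with `U` standard and `V` independent of it with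
covariance `K_V`, because the covariances agree (`map_multivariateGaussian_pair`). The delicate one
is `F (Q Λ)ᵀ = D K Γ` for singular `Λ` (`conditional_cross_covariance`). Given `U`, the event reads
`V ≤ r + δ - η`, whose probability is the integrand.

Independence and Fubini then average over the symbols, which take only finitely many values in the
windows. -/

theorem posDef_Smat_mul_transpose (m : ℕ) : (Smat m * (Smat m)ᵀ).PosDef := by
  have := Matrix.PosDef.mul_conjTranspose_self (Smat m) (fun v w hvw => by
    ext j
    -- The unit vectors are among the columns of `S`, so its rows are linearly independent.
    have := congrFun hvw (Pi.single j 1)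
    have key : ∀ v : Fin (2 * m) → ℝ, (v ᵥ* Smat m) (Pi.single j 1) = v j := by
      intro v
      simp only [Matrix.vecMul, dotProduct, Smat, Matrix.of_apply]
      rw [Finset.sum_eq_single j]
      · simp
      · intro b _ hb
        simp [Pi.single_eq_of_ne hb]
      · simp
    simpa [key] using this)
  simpa [Matrix.conjTranspose_eq_transpose_of_trivial] using this

theorem posDef_kronSS (m n : ℕ) : (kronSS m n).PosDef :=
  Matrix.PosDef.kronecker Matrix.PosDef.one (posDef_Smat_mul_transpose m)

/-! ### Simultaneous diagonalization and conditional covariances. -/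

section LinearAlgebra

/-- Each column `x` of `X` satisfies `xᵀ K x = 0`, which forces `K x = 0` for positive semidefinite
`K`: a combination of zero variance is uncorrelated with everything. -/
theorem mul_eq_zero_of_transpose_mul_mul_eq_zero {κ p : Type*} [Fintype κ] {K : Matrix κ κ ℝ} (hK : K.PosSemidef)
    {X : Matrix κ p ℝ} (h : Xᵀ * K * X = 0) : K * X = 0 := by
  classical
  ext i j
  have h1 : X.col j ⬝ᵥ (K *ᵥ X.col j) = 0 := by
    have := congrFun (congrFun h j) j
    rw [Matrix.mul_assoc] at this
    simpa [Matrix.mul_apply, dotProduct, Matrix.mulVec] using this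
  have h2 := (hK.dotProduct_mulVec_zero_iff (X.col j)).mp (by simpa using h1)
  simpa [Matrix.mul_apply, dotProduct, Matrix.mulVec] using congrFun h2 i

variable {p κ ν : Type*} [Fintype p] [DecidableEq p] [Fintype κ]

open scoped MatrixOrder in
/-- Simultaneous diagonalization by congruence of a positive semidefinite matrix `M` and a positive
definite matrix `N`. -/
theorem exists_simultaneous_diagonalization {M N : Matrix p p ℝ} (hM : M.PosSemidef)
    (hN : N.PosDef) :
    ∃ (Q : Matrix p p ℝ) (d : p → ℝ), Q * Matrix.diagonal d ^ 2 * Qᵀ = M ∧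
      {q | 0 < d q}.ncard = M.rank ∧ Qᵀ * N * Q = 1 := by
  -- With `N = Bᵀ B` and an orthogonal `O` diagonalizing `B M Bᵀ`, the witness is `Q = B⁻¹ O`; `d`
  -- holds the square roots of the eigenvalues.
  obtain ⟨B, hB⟩ := CStarAlgebra.nonneg_iff_eq_star_mul_self.mp hN.posSemidef.nonneg
  rw [Matrix.star_eq_conjTranspose, Matrix.conjTranspose_eq_transpose_of_trivial] at hB
  have hBu : IsUnit B.det := by
    have h1 := (Matrix.isUnit_iff_isUnit_det _).mp hN.isUnit
    rw [hB, Matrix.det_mul] at h1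
    exact isUnit_of_mul_isUnit_right h1
  have hM' : (B * M * Bᵀ).PosSemidef := by
    simpa [Matrix.conjTranspose_eq_transpose_of_trivial] using hM.mul_mul_conjTranspose_same B
  have hsp := hM'.1.spectral_theorem
  set e := hM'.1.eigenvalues with he
  set O : Matrix p p ℝ := (hM'.1.eigenvectorUnitary : Matrix p p ℝ) with hO
  have hOO : Oᵀ * O = 1 := by
    have := Matrix.UnitaryGroup.star_mul_self hM'.1.eigenvectorUnitary
    simpa [Matrix.star_eq_conjTranspose, Matrix.conjTranspose_eq_transpose_of_trivial] using this
  have hsp' : B * M * Bᵀ = O * Matrix.diagonal e * Oᵀ := by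
    rw [hsp, Unitary.conjStarAlgAut_apply]
    simp [Matrix.star_eq_conjTranspose, Matrix.conjTranspose_eq_transpose_of_trivial, hO, he]
  have hd : Matrix.diagonal (fun q => Real.sqrt (e q)) ^ 2 = Matrix.diagonal e := by
    rw [Matrix.diagonal_pow]
    congr 1
    ext q
    simpa using Real.sq_sqrt (hM'.eigenvalues_nonneg q)
  have hBB : B⁻¹ * B = 1 := Matrix.nonsing_inv_mul _ hBu
  have hBB' : Bᵀ * B⁻¹ᵀ = 1 := by rw [← Matrix.transpose_mul, hBB, Matrix.transpose_one]
  have hBB2 : B * B⁻¹ = 1 := Matrix.mul_nonsing_inv _ hBu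
  have hBB2' : B⁻¹ᵀ * Bᵀ = 1 := by rw [← Matrix.transpose_mul, hBB2, Matrix.transpose_one]
  refine ⟨B⁻¹ * O, fun q => Real.sqrt (e q), ?_, ?_, ?_⟩
  · rw [hd]
    calc B⁻¹ * O * Matrix.diagonal e * (B⁻¹ * O)ᵀ
        = B⁻¹ * (O * Matrix.diagonal e * Oᵀ) * B⁻¹ᵀ := by
          rw [Matrix.transpose_mul]; simp only [Matrix.mul_assoc]
      _ = (B⁻¹ * B) * M * (Bᵀ * B⁻¹ᵀ) := by rw [← hsp']; simp only [Matrix.mul_assoc]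
      _ = M := by rw [hBB, hBB', one_mul, mul_one]
  · have hr : M.rank = (B * M * Bᵀ).rank := by
      rw [Matrix.rank_mul_eq_left_of_isUnit_det _ _ (by rwa [Matrix.det_transpose]),
        Matrix.rank_mul_eq_right_of_isUnit_det _ _ hBu]
    rw [hr, hM'.1.rank_eq_card_non_zero_eigs, ← Nat.card_eq_fintype_card, ← Nat.card_coe_set_eq]
    have : {q | 0 < Real.sqrt (e q)} = {q | hM'.1.eigenvalues q ≠ 0} := by
      ext q
      simpa [Real.sqrt_pos] using (hM'.eigenvalues_nonneg q).lt_iff_ne'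
    rw [this]
    rfl
  · calc (B⁻¹ * O)ᵀ * N * (B⁻¹ * O) = Oᵀ * ((B⁻¹ᵀ * Bᵀ) * (B * B⁻¹)) * O := by
          rw [Matrix.transpose_mul, hB]; simp only [Matrix.mul_assoc]
      _ = 1 := by rw [hBB2, hBB2', mul_one, mul_one, hOO]

variable {K : Matrix κ κ ℝ} {G : Matrix κ p ℝ} {N Q : Matrix p p ℝ} {d : p → ℝ}

/-- For invertible `Λ` this is just `N Q Qᵀ = 1`. In general `Λ† Λ = 1 - R`, where `R` projects onto
the zero entries of `Λ`; the columns of `G N Q R` have zero variance under `K`, so `K` annihilates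
them and the defect `R` contributes nothing. -/
theorem conditional_cross_covariance (hK : K.PosSemidef)
    (h1 : Q * Matrix.diagonal d ^ 2 * Qᵀ = Gᵀ * K * G) (hN : Nᵀ = N) (h2 : Qᵀ * N * Q = 1)
    (D : Matrix ν κ ℝ) :
    D * K * G * (N * Q) * Matrix.diagonal (fun q => (d q)⁻¹) * (Q * Matrix.diagonal d)ᵀ =
      D * K * G := by
  -- One-sided inverses of square matrices are two-sided, used twice.
  have h3 : N * Q * Qᵀ = 1 := by
    rw [Matrix.mul_assoc, mul_eq_one_comm, Matrix.mul_assoc]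
    exact mul_eq_one_comm.mp (by rw [← h2, Matrix.mul_assoc])
  set R : Matrix p p ℝ := Matrix.diagonal fun q => 1 - (d q)⁻¹ * d q with hR
  have h4 : K * (G * (N * Q) * R) = 0 := by
    apply mul_eq_zero_of_transpose_mul_mul_eq_zero hK
    calc (G * (N * Q) * R)ᵀ * K * (G * (N * Q) * R)
        = Rᵀ * (Qᵀ * Nᵀ * (Gᵀ * K * G) * (N * Q)) * R := by
          simp only [Matrix.transpose_mul, Matrix.mul_assoc]
      _ = Rᵀ * ((Qᵀ * N * Q) * Matrix.diagonal d ^ 2 * (Qᵀ * N * Q)) * R := by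
          rw [hN, ← h1]; simp only [Matrix.mul_assoc]
      _ = 0 := by
          rw [h2, one_mul, mul_one, Matrix.diagonal_pow, hR, Matrix.diagonal_transpose,
            Matrix.diagonal_mul_diagonal, Matrix.diagonal_mul_diagonal, ← Matrix.diagonal_zero]
          congr 1
          ext q
          by_cases hq : d q = 0 <;> simp [hq]
  have h5 : Matrix.diagonal (fun q => (d q)⁻¹) * Matrix.diagonal d = 1 - R := by
    rw [hR, ← Matrix.diagonal_one, Matrix.diagonal_sub, Matrix.diagonal_mul_diagonal]
    congr 1
    ext q
    simp
  calc _ = D * K * G * (N * Q) * (Matrix.diagonal (fun q => (d q)⁻¹) * Matrix.diagonal d) * Qᵀ := by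
        simp only [Matrix.transpose_mul, Matrix.mul_assoc, Matrix.diagonal_transpose]
    _ = D * K * G * (N * Q * Qᵀ) - D * (K * (G * (N * Q) * R)) * Qᵀ := by
        rw [h5, Matrix.mul_sub, Matrix.sub_mul, Matrix.mul_one]; simp only [Matrix.mul_assoc]
    _ = D * K * G := by rw [h3, h4]; simp

/-- With `B = G N Q Λ†` the matrix equals `(D - F Bᵀ) K (D - F Bᵀ)ᵀ`, the covariance of the residual
of `D W` after regression on `Bᵀ W`. -/
theorem posSemidef_conditional_covariance [Finite ν] (hK : K.PosSemidef)
    (h1 : Q * Matrix.diagonal d ^ 2 * Qᵀ = Gᵀ * K * G) (hN : Nᵀ = N) (h2 : Qᵀ * N * Q = 1)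
    (D : Matrix ν κ ℝ) {F : Matrix ν p ℝ}
    (hF : F = D * K * G * (N * Q) * Matrix.diagonal (fun q => (d q)⁻¹)) :
    (D * K * Dᵀ - F * Fᵀ).PosSemidef := by
  set L : Matrix p p ℝ := Matrix.diagonal fun q => (d q)⁻¹ with hL
  have hLt : Lᵀ = L := Matrix.diagonal_transpose _
  set B : Matrix κ p ℝ := G * (N * Q) * L with hB
  have hKt : Kᵀ = K := by
    simpa [Matrix.conjTranspose_eq_transpose_of_trivial] using hK.1.eq
  have hFB : F = D * K * B := by rw [hF, hB]; simp only [Matrix.mul_assoc]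
  have hFt : Fᵀ = Bᵀ * K * Dᵀ := by
    rw [hFB]; simp only [Matrix.transpose_mul, Matrix.mul_assoc, hKt]
  have hBKB : Bᵀ * K * B = L * Matrix.diagonal d ^ 2 * L := by
    calc Bᵀ * K * B = L * (Qᵀ * N * (Gᵀ * K * G) * (N * Q)) * L := by
          rw [hB]; simp only [Matrix.transpose_mul, Matrix.mul_assoc, hLt, hN]
      _ = L * ((Qᵀ * N * Q) * Matrix.diagonal d ^ 2 * (Qᵀ * N * Q)) * L := by
          rw [← h1]; simp only [Matrix.mul_assoc]
      _ = _ := by rw [h2, one_mul, mul_one]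
  -- `Bᵀ K B = Λ† Λ² Λ†` is the projection onto the non-zero entries of `Λ`, and `F` ends in `Λ†`.
  have hFP : F * (Bᵀ * K * B) = F := by
    rw [hBKB, hF]
    have : L * (L * Matrix.diagonal d ^ 2 * L) = L := by
      rw [hL, Matrix.diagonal_pow]
      simp only [Matrix.diagonal_mul_diagonal]
      congr 1
      ext q
      by_cases hq : d q = 0
      · simp [hq]
      · simp only [Pi.pow_apply]; field_simp
    rw [Matrix.mul_assoc, this]
  have key : D * K * Dᵀ - F * Fᵀ = (D - F * Bᵀ) * K * (D - F * Bᵀ)ᵀ := by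
    have e1 : (D - F * Bᵀ)ᵀ = Dᵀ - B * Fᵀ := by
      rw [Matrix.transpose_sub, Matrix.transpose_mul, Matrix.transpose_transpose]
    rw [e1]
    calc D * K * Dᵀ - F * Fᵀ
        = D * K * Dᵀ - F * (Bᵀ * K * Dᵀ) - (D * K * B) * Fᵀ + (F * (Bᵀ * K * B)) * Fᵀ := by
          rw [hFP, ← hFB, ← hFt]; abel
      _ = _ := by
          simp only [Matrix.sub_mul, Matrix.mul_sub, Matrix.mul_assoc]; abel
  rw [key]
  simpa [Matrix.conjTranspose_eq_transpose_of_trivial] using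
    hK.mul_mul_conjTranspose_same (D - F * Bᵀ)

end LinearAlgebra

/-! ### Gaussian laws via characteristic functions. -/

section GaussianLaws

open Complex WithLp
open scoped RealInnerProductSpace

/-- The finite-dimensional distributions of a centered real Gaussian process. -/
theorem map_gaussianProcess {Ω T ι : Type*} [MeasurableSpace Ω] {P : Measure Ω}
    [Fintype ι] [DecidableEq ι] {W : T → Ω → ℝ} (hW : IsGaussianProcess W P)
    (hW0 : ∀ s, ∫ ω, W s ω ∂P = 0) (s : ι → T) :
    (Matrix.of fun p q => ∫ ω, W (s p) ω * W (s q) ω ∂P).PosSemidef ∧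
      P.map (fun ω => toLp 2 fun p => W (s p) ω) =
        multivariateGaussian 0 (Matrix.of fun p q => ∫ ω, W (s p) ω * W (s q) ω ∂P) := by
  have hprob : IsProbabilityMeasure P := hW.isProbabilityMeasure
  set K : Matrix ι ι ℝ := Matrix.of fun p q => ∫ ω, W (s p) ω * W (s q) ω ∂P with hK
  have h2 : ∀ q, MemLp (W (s q)) 2 P := fun q => (hW.hasGaussianLaw_eval (s q)).memLp_two
  have hint : ∀ p q, Integrable (fun ω => W (s p) ω * W (s q) ω) P := fun p q =>
    (h2 p).integrable_mul (h2 q)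
  -- The quadratic form of `K` is a second moment: this yields both semidefiniteness and the
  -- variance in the characteristic function.
  have hquad : ∀ x : ι → ℝ, ∫ ω, (∑ p, x p * W (s p) ω) ^ 2 ∂P = x ⬝ᵥ K *ᵥ x := by
    intro x
    have : ∀ ω, (∑ p, x p * W (s p) ω) ^ 2 = ∑ p, ∑ q, x p * x q * (W (s p) ω * W (s q) ω) := by
      intro ω
      rw [sq, Finset.sum_mul_sum]
      exact Finset.sum_congr rfl fun p _ => Finset.sum_congr rfl fun q _ => by ring
    simp_rw [this]
    rw [integral_finsetSum _ fun p _ => integrable_finsetSum _ fun q _ => (hint p q).const_mul _]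
    simp only [dotProduct, Matrix.mulVec, Finset.mul_sum]
    refine Finset.sum_congr rfl fun p _ => ?_
    rw [integral_finsetSum _ fun q _ => (hint p q).const_mul _]
    refine Finset.sum_congr rfl fun q _ => ?_
    rw [integral_const_mul, hK, Matrix.of_apply]
    ring
  have hpsd : K.PosSemidef := by
    refine Matrix.PosSemidef.of_dotProduct_mulVec_nonneg ?_ fun x => ?_
    · ext p q
      simp [hK, mul_comm]
    · rw [star_trivial, ← hquad]
      exact integral_nonneg fun ω => sq_nonneg _
  refine ⟨hpsd, ?_⟩
  have hG : HasGaussianLaw (fun ω => toLp 2 fun p => W (s p) ω) P := by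
    -- `s` need not be injective: overlapping windows repeat noise samples.
    have h1 := (hW.comp_right s).hasGaussianLaw Finset.univ
    let Lr : ({i // i ∈ (Finset.univ : Finset ι)} → ℝ) →L[ℝ] (ι → ℝ) :=
      ContinuousLinearMap.pi fun i => ContinuousLinearMap.proj ⟨i, Finset.mem_univ i⟩
    exact (h1.map Lr).toLp_pi 2
  have := hG.isGaussian_map
  refine Measure.ext_of_charFun (funext fun x => ?_)
  rw [hG.charFun_map_eq, charFun_multivariateGaussian hpsd]
  have hin : ∀ ω, ⟪x, toLp 2 fun p => W (s p) ω⟫ = ∑ p, x p * W (s p) ω := by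
    intro ω
    simp [PiLp.inner_apply, mul_comm]
  have hmean : ∫ ω, ⟪x, toLp 2 fun p => W (s p) ω⟫ ∂P = 0 := by
    simp_rw [hin]
    rw [integral_finsetSum _ fun p _ => ((h2 p).integrable one_le_two).const_mul _]
    simp [integral_const_mul, hW0]
  rw [variance_of_integral_eq_zero _ hmean, hmean]
  · simp_rw [hin, hquad]
    simp
  · simp_rw [hin]
    exact Finset.aemeasurable_fun_sum _ fun p _ => (hW.aemeasurable (s p)).const_mul _

theorem charFun_map_congr {E F G : Type*} [MeasurableSpace E] [NormedAddCommGroup F]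
    [InnerProductSpace ℝ F] [MeasurableSpace F] [OpensMeasurableSpace F] [NormedAddCommGroup G]
    [InnerProductSpace ℝ G] [MeasurableSpace G] [OpensMeasurableSpace G]
    [SecondCountableTopology F] [SecondCountableTopology G] {μ : Measure E} {f : E → F} {g : E → G}
    (hf : Measurable f) (hg : Measurable g) {t : F} {y : G} (h : ∀ w, ⟪f w, t⟫ = ⟪g w, y⟫) :
    charFun (μ.map f) t = charFun (μ.map g) y := by
  rw [charFun_apply, charFun_apply, integral_map hf.aemeasurable (by fun_prop),
    integral_map hg.aemeasurable (by fun_prop)]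
  simp_rw [h]

theorem inner_eq_dotProduct {ι : Type*} [Fintype ι] (a b : EuclideanSpace ℝ ι) :
    ⟪a, b⟫ = ofLp a ⬝ᵥ ofLp b := by
  simp [PiLp.inner_apply, dotProduct, mul_comm]

theorem mulVec_dotProduct {a b : Type*} [Fintype a] [Fintype b] (M : Matrix a b ℝ) (v : b → ℝ)
    (w : a → ℝ) : (M *ᵥ v) ⬝ᵥ w = v ⬝ᵥ (Mᵀ *ᵥ w) := by
  rw [dotProduct_comm, Matrix.dotProduct_mulVec, Matrix.mulVec_transpose, dotProduct_comm]

/-- A pair of linear images of a centered Gaussian vector has the same law as a pair in which the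
second component is a linear image of a standard Gaussian vector `u`, and the first one is the sum
of a linear image of `u` and of an independent Gaussian vector. -/
theorem map_multivariateGaussian_pair {κ ν p q : Type*} [Fintype κ] [DecidableEq κ] [Fintype ν]
    [DecidableEq ν] [Fintype p] [Fintype q] [DecidableEq q] {K : Matrix κ κ ℝ} (hK : K.PosSemidef)
    {V : Matrix ν ν ℝ} (hV : V.PosSemidef) (D : Matrix ν κ ℝ) (G : Matrix κ p ℝ)
    (F : Matrix ν q ℝ) (L : Matrix p q ℝ) (hDD : D * K * Dᵀ = F * Fᵀ + V)
    (hDG : D * K * G = F * Lᵀ) (hGG : Gᵀ * K * G = L * Lᵀ) :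
    (multivariateGaussian 0 K).map
        (fun w => toLp 2 (Sum.elim (D *ᵥ ofLp w) (Gᵀ *ᵥ ofLp w))) =
      ((stdGaussian (EuclideanSpace ℝ q)).prod (multivariateGaussian 0 V)).map
        (fun x => toLp 2 (Sum.elim (F *ᵥ ofLp x.1 + ofLp x.2) (L *ᵥ ofLp x.1))) := by
  have hf1 : Measurable (fun w : EuclideanSpace ℝ κ =>
      toLp 2 (Sum.elim (D *ᵥ ofLp w) (Gᵀ *ᵥ ofLp w))) := by
    refine (WithLp.measurable_toLp 2 _).comp (measurable_pi_iff.mpr ?_)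
    rintro (i | i) <;> simp only [Sum.elim_inl, Sum.elim_inr, Matrix.mulVec, dotProduct] <;>
      fun_prop
  have hf2 : Measurable (fun x : EuclideanSpace ℝ q × EuclideanSpace ℝ ν =>
      toLp 2 (Sum.elim (F *ᵥ ofLp x.1 + ofLp x.2) (L *ᵥ ofLp x.1))) := by
    refine (WithLp.measurable_toLp 2 _).comp (measurable_pi_iff.mpr ?_)
    rintro (i | i) <;> simp only [Sum.elim_inl, Sum.elim_inr, Matrix.mulVec, dotProduct,
      Pi.add_apply] <;> fun_prop
  have := Measure.isProbabilityMeasure_map (μ := multivariateGaussian 0 K) hf1.aemeasurable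
  have := Measure.isProbabilityMeasure_map
    (μ := (stdGaussian (EuclideanSpace ℝ q)).prod (multivariateGaussian 0 V)) hf2.aemeasurable
  refine Measure.ext_of_charFun (funext fun t => ?_)
  set x : ν → ℝ := fun i => t (Sum.inl i) with hx
  set y : p → ℝ := fun i => t (Sum.inr i) with hy
  have hin : ∀ a b, ⟪(toLp 2 (Sum.elim a b) : EuclideanSpace ℝ (ν ⊕ p)), t⟫ =
      a ⬝ᵥ x + b ⬝ᵥ y := by
    intro a b
    simp [PiLp.inner_apply, dotProduct, hx, hy, mul_comm]
  have e1 : charFun ((multivariateGaussian 0 K).map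
      (fun w => toLp 2 (Sum.elim (D *ᵥ ofLp w) (Gᵀ *ᵥ ofLp w)))) t =
      charFun (multivariateGaussian 0 K) (toLp 2 (Dᵀ *ᵥ x + G *ᵥ y)) := by
    conv_rhs => rw [← Measure.map_id (μ := multivariateGaussian 0 K)]
    refine charFun_map_congr hf1 measurable_id fun w => ?_
    rw [hin, inner_eq_dotProduct, mulVec_dotProduct, mulVec_dotProduct,
      Matrix.transpose_transpose, dotProduct_add]
    rfl
  have e2 : charFun (((stdGaussian (EuclideanSpace ℝ q)).prod (multivariateGaussian 0 V)).map
        (fun x => toLp 2 (Sum.elim (F *ᵥ ofLp x.1 + ofLp x.2) (L *ᵥ ofLp x.1)))) t =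
      charFun (stdGaussian (EuclideanSpace ℝ q)) (toLp 2 (Fᵀ *ᵥ x + Lᵀ *ᵥ y)) *
        charFun (multivariateGaussian 0 V) (toLp 2 x) := by
    rw [← charFun_prod (toLp 2 (toLp 2 (Fᵀ *ᵥ x + Lᵀ *ᵥ y), toLp 2 x))]
    refine charFun_map_congr hf2 (WithLp.measurable_toLp 2 _) fun w => ?_
    rw [hin, prod_inner_apply]
    simp only [inner_eq_dotProduct]
    rw [add_dotProduct, mulVec_dotProduct, mulVec_dotProduct, dotProduct_add]
    ring
  have hKt : Kᵀ = K := by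
    simpa [Matrix.conjTranspose_eq_transpose_of_trivial] using hK.1.eq
  have hGD : Gᵀ * K * Dᵀ = L * Fᵀ := by
    have := congrArg Matrix.transpose hDG
    simpa [Matrix.transpose_mul, hKt, Matrix.mul_assoc] using this
  -- The exponents of the two characteristic functions agree exactly by the three covariance
  -- identities and the transpose of the mixed one.
  have hquad : (Dᵀ *ᵥ x + G *ᵥ y) ⬝ᵥ (K *ᵥ (Dᵀ *ᵥ x + G *ᵥ y)) =
      (Fᵀ *ᵥ x + Lᵀ *ᵥ y) ⬝ᵥ (Fᵀ *ᵥ x + Lᵀ *ᵥ y) + x ⬝ᵥ (V *ᵥ x) := by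
    simp only [Matrix.mulVec_add, add_dotProduct, dotProduct_add, mulVec_dotProduct,
      Matrix.mulVec_mulVec, Matrix.transpose_transpose, ← Matrix.mul_assoc, hDD, hDG, hGG, hGD,
      Matrix.add_mulVec]
    ring
  have hnorm : ‖(toLp 2 (Fᵀ *ᵥ x + Lᵀ *ᵥ y) : EuclideanSpace ℝ q)‖ ^ 2 =
      (Fᵀ *ᵥ x + Lᵀ *ᵥ y) ⬝ᵥ (Fᵀ *ᵥ x + Lᵀ *ᵥ y) := by
    rw [← real_inner_self_eq_norm_sq, inner_eq_dotProduct]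
  rw [e1, e2, charFun_multivariateGaussian hK, charFun_multivariateGaussian hV,
    charFun_stdGaussian, ← Complex.exp_add, ← Complex.ofReal_pow, hnorm]
  simp only [inner_zero_right, ofReal_zero, zero_mul, zero_sub]
  rw [hquad]
  push_cast
  ring_nf

end GaussianLaws

/-! ### Candidates as sign flips, and closed forms of `X` and `Y`. -/

section Channel

theorem Hmat_add_Tmat (m : ℕ) {ℓ : ℕ} (h : Fin (ℓ + 1) → ℝ) :
    Hmat m h + Tmat m h = Matrix.of fun (k : Fin (2 * m + ℓ + 1)) (p : Fin (2 * (m + ℓ) + 1)) =>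
      coef h (((k : ℕ) : ℤ) + (ℓ : ℤ) - ((p : ℕ) : ℤ)) := by
  ext k p
  simp only [Hmat, Tmat, Matrix.add_apply, Matrix.of_apply, hVec]
  split_ifs
  · rw [add_zero]; congr 1; ring
  · rw [zero_add]

theorem outputWindow_channelOutput {Ω : Type*} (m : ℕ) {ℓ : ℕ} (h : Fin (ℓ + 1) → ℝ)
    (A W : ℤ → Ω → ℝ) (t : ℤ) (ω : Ω) :
    outputWindow m ℓ (channelOutput h A W) t ω =
      (Hmat m h + Tmat m h) *ᵥ symbolWindow m ℓ A t ω - outputWindow m ℓ W t ω := by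
  ext k
  rw [Hmat_add_Tmat]
  simp only [outputWindow, channelOutput, Pi.sub_apply, Matrix.mulVec, dotProduct, Matrix.of_apply,
    symbolWindow, coef, Finset.sum_mul]
  congr 1
  rw [Finset.sum_comm]
  refine Finset.sum_congr rfl fun i _ => ?_
  have hk := k.2
  have hi := i.2
  -- The only column of row `k` that carries `h_i`; the subtraction does not truncate since `i ≤ ℓ`.
  rw [Finset.sum_eq_single ⟨(k : ℕ) + ℓ - i, by omega⟩]
  · have e : (((k : ℕ) + ℓ - i : ℕ) : ℤ) = (k : ℕ) + ℓ - (i : ℕ) := by omega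
    rw [e, if_pos (by ring)]
    congr 2
    ring
  · intro p _ hp
    rw [if_neg, zero_mul]
    intro hc
    exact hp (Fin.ext (by simp only; omega))
  · simp

theorem offset_ne_zero (m : ℕ) (j : Fin (2 * m)) : offset m j ≠ 0 := by
  unfold offset; split_ifs <;> omega

theorem offset_injective (m : ℕ) : Function.Injective (offset m) := by
  intro i j hij
  unfold offset at hij
  apply Fin.ext
  split_ifs at hij <;> omega

/-- The position, in a sequence of length `2(m+ℓ)+1`, of the `j`-th nonzero offset. -/
def position (m ℓ : ℕ) (j : Fin (2 * m)) : Fin (2 * (m + ℓ) + 1) :=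
  ⟨((m : ℤ) + ℓ + offset m j).toNat, by have := j.2; unfold offset; split_ifs <;> omega⟩

theorem coe_position (m ℓ : ℕ) (j : Fin (2 * m)) :
    ((position m ℓ j : ℕ) : ℤ) = (m : ℤ) + ℓ + offset m j := by
  have := j.2
  simp only [position]
  unfold offset
  split_ifs <;> omega

theorem position_injective (m ℓ : ℕ) : Function.Injective (position m ℓ) := by
  intro i j hij
  have h1 := coe_position m ℓ i
  rw [hij, coe_position] at h1
  exact (offset_injective m (by linarith)).symm

theorem position_ne_center (m ℓ : ℕ) (j : Fin (2 * m)) : position m ℓ j ≠ center m ℓ := by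
  intro hc
  have h1 := coe_position m ℓ j
  rw [hc] at h1
  have := offset_ne_zero m j
  simp only [center] at h1
  omega

theorem abs_position_le (m ℓ : ℕ) (j : Fin (2 * m)) :
    |((position m ℓ j : ℕ) : ℤ) - ((m : ℤ) + (ℓ : ℤ))| ≤ m := by
  have := j.2
  rw [coe_position, abs_le]
  unfold offset
  split_ifs <;> omega

theorem exists_position_eq {m ℓ : ℕ} {p : Fin (2 * (m + ℓ) + 1)}
    (hp : |((p : ℕ) : ℤ) - ((m : ℤ) + (ℓ : ℤ))| ≤ m) (hc : p ≠ center m ℓ) :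
    ∃ j, position m ℓ j = p := by
  have hc' : (p : ℕ) ≠ m + ℓ := fun e => hc (Fin.ext e)
  rw [abs_le] at hp
  by_cases hlt : (p : ℕ) < m + ℓ
  · refine ⟨⟨p - ℓ, by omega⟩, Fin.ext ?_⟩
    have := coe_position m ℓ ⟨p - ℓ, by omega⟩
    simp only [offset] at this
    split_ifs at this <;> omega
  -- The extra `- 1` accounts for the skipped offset 0.
  · refine ⟨⟨p - ℓ - 1, by omega⟩, Fin.ext ?_⟩
    have := coe_position m ℓ ⟨p - ℓ - 1, by omega⟩
    simp only [offset] at this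
    split_ifs at this <;> omega

theorem Emat_apply (m ℓ : ℕ) (p : Fin (2 * (m + ℓ) + 1)) (j : Fin (2 * m)) :
    Emat m ℓ p j = if p = position m ℓ j then 1 else 0 := by
  simp only [Emat, Matrix.of_apply]
  congr 1
  rw [← coe_position, Fin.ext_iff, eq_iff_iff]
  omega

theorem Emat_mulVec_position (m ℓ : ℕ) (v : Fin (2 * m) → ℝ) (j : Fin (2 * m)) :
    (Emat m ℓ *ᵥ v) (position m ℓ j) = v j := by
  simp [Matrix.mulVec, dotProduct, Emat_apply, (position_injective m ℓ).eq_iff]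

theorem Emat_mulVec_center (m ℓ : ℕ) (v : Fin (2 * m) → ℝ) :
    (Emat m ℓ *ᵥ v) (center m ℓ) = 0 := by
  simp [Matrix.mulVec, dotProduct, Emat_apply, (position_ne_center m ℓ _).symm]

theorem abs_center_le (m ℓ : ℕ) :
    |((center m ℓ : ℕ) : ℤ) - ((m : ℤ) + (ℓ : ℤ))| ≤ m := by
  simp [center]

/-- The candidate obtained from `a` by changing the signs at the nonzero offsets selected by `s`
and, if `σ = 1`, the sign at offset `0`. -/
def flip (m ℓ : ℕ) (a : Fin (2 * (m + ℓ) + 1) → ℝ) (σ : Fin 2) (s : Fin (2 * m) → Fin 2) :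
    Fin (2 * (m + ℓ) + 1) → ℝ :=
  fun p => if (m : ℤ) < |((p : ℕ) : ℤ) - ((m : ℤ) + (ℓ : ℤ))| then 1 else
    a p - 2 * (a p * (Emat m ℓ *ᵥ fun j => Smat m j s) p) -
      2 * ((σ : ℕ) : ℝ) * a (center m ℓ) *
        (Pi.single (center m ℓ) (1 : ℝ) : Fin (2 * (m + ℓ) + 1) → ℝ) p

theorem flip_center (m ℓ : ℕ) (a : Fin (2 * (m + ℓ) + 1) → ℝ) (σ : Fin 2)
    (s : Fin (2 * m) → Fin 2) :
    flip m ℓ a σ s (center m ℓ) = (1 - 2 * ((σ : ℕ) : ℝ)) * a (center m ℓ) := by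
  rw [flip, if_neg (not_lt.mpr (abs_center_le m ℓ)), Emat_mulVec_center, Pi.single_eq_same]
  ring

theorem flip_position (m ℓ : ℕ) (a : Fin (2 * (m + ℓ) + 1) → ℝ) (σ : Fin 2)
    (s : Fin (2 * m) → Fin 2) (j : Fin (2 * m)) :
    flip m ℓ a σ s (position m ℓ j) = (1 - 2 * ((s j : ℕ) : ℝ)) * a (position m ℓ j) := by
  rw [flip, if_neg (not_lt.mpr (abs_position_le m ℓ j)), Emat_mulVec_position,
    Pi.single_eq_of_ne (position_ne_center m ℓ j), Smat, Matrix.of_apply]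
  ring

theorem sign_mul {x : ℝ} (hx : x = -1 ∨ x = 1) (σ : Fin 2) :
    (1 - 2 * ((σ : ℕ) : ℝ)) * x = -1 ∨ (1 - 2 * ((σ : ℕ) : ℝ)) * x = 1 := by
  fin_cases σ <;> rcases hx with rfl | rfl <;> norm_num

theorem eq_sign_mul {x y : ℝ} (hx : x = -1 ∨ x = 1) (hy : y = -1 ∨ y = 1) :
    ∃ σ : Fin 2, (1 - 2 * ((σ : ℕ) : ℝ)) * x = y := by
  rcases hx with rfl | rfl <;> rcases hy with rfl | rfl
  · exact ⟨0, by norm_num⟩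
  · exact ⟨1, by norm_num⟩
  · exact ⟨1, by norm_num⟩
  · exact ⟨0, by norm_num⟩

theorem flip_mem_candidates {m ℓ : ℕ} {a : Fin (2 * (m + ℓ) + 1) → ℝ}
    (ha : ∀ p, a p = -1 ∨ a p = 1) (σ : Fin 2) (s : Fin (2 * m) → Fin 2) :
    flip m ℓ a σ s ∈ candidates m ℓ := by
  refine ⟨fun p => ?_, fun p hp => by rw [flip, if_pos hp]⟩
  by_cases hp : (m : ℤ) < |((p : ℕ) : ℤ) - ((m : ℤ) + (ℓ : ℤ))|
  · exact Or.inr (by rw [flip, if_pos hp])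
  by_cases hc : p = center m ℓ
  · rw [hc, flip_center]
    exact sign_mul (ha _) σ
  · obtain ⟨j, rfl⟩ := exists_position_eq (not_lt.mp hp) hc
    rw [flip_position]
    exact sign_mul (ha _) (s j)

theorem exists_flip_eq {m ℓ : ℕ} {a c : Fin (2 * (m + ℓ) + 1) → ℝ}
    (ha : ∀ p, a p = -1 ∨ a p = 1) (hc : c ∈ candidates m ℓ) (σ : Fin 2)
    (hσ : (1 - 2 * ((σ : ℕ) : ℝ)) * a (center m ℓ) = c (center m ℓ)) :
    ∃ s, flip m ℓ a σ s = c := by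
  choose s hs using fun j : Fin (2 * m) => eq_sign_mul (ha (position m ℓ j)) (hc.1 (position m ℓ j))
  refine ⟨s, funext fun p => ?_⟩
  by_cases hp : (m : ℤ) < |((p : ℕ) : ℤ) - ((m : ℤ) + (ℓ : ℤ))|
  · rw [flip, if_pos hp, hc.2 p hp]
  by_cases hpc : p = center m ℓ
  · rw [hpc, flip_center, hσ]
  · obtain ⟨j, rfl⟩ := exists_position_eq (not_lt.mp hp) hpc
    rw [flip_position, hs]

/-- Flipping the sign of `a_p` subtracts `2 a_p`. The forced ones beyond offset `m` meet zero
columns of `H`, and the central column of `H` is `h₀`. -/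
theorem Hmat_mulVec_sub_flip (m : ℕ) {ℓ : ℕ} (h : Fin (ℓ + 1) → ℝ)
    (a : Fin (2 * (m + ℓ) + 1) → ℝ) (σ : Fin 2) (s : Fin (2 * m) → Fin 2) :
    Hmat m h *ᵥ (a - flip m ℓ a σ s) =
      (2 : ℝ) • ((Gmat m h a *ᵥ fun j => Smat m j s) +
        (((σ : ℕ) : ℝ) * a (center m ℓ)) • hVec m h 0) := by
  have h1 : Hmat m h *ᵥ (a - flip m ℓ a σ s) =
      Hmat m h *ᵥ ((2 : ℝ) • ((Matrix.diagonal a *ᵥ (Emat m ℓ *ᵥ fun j => Smat m j s)) +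
        (((σ : ℕ) : ℝ) * a (center m ℓ)) • Pi.single (center m ℓ) (1 : ℝ))) := by
    ext k
    simp only [Matrix.mulVec, dotProduct]
    refine Finset.sum_congr rfl fun p _ => ?_
    by_cases hp : (m : ℤ) < |((p : ℕ) : ℤ) - ((m : ℤ) + (ℓ : ℤ))|
    · have : Hmat m h k p = 0 := by
        rw [Hmat, Matrix.of_apply, if_neg]
        rw [lt_abs] at hp
        omega
      rw [this, zero_mul, zero_mul]
    · congr 1
      rw [Pi.sub_apply, flip, if_neg hp]
      simp only [Pi.smul_apply, Pi.add_apply, smul_eq_mul]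
      rw [Matrix.mulVec_diagonal]
      ring
  have h2 : Hmat m h *ᵥ Pi.single (center m ℓ) (1 : ℝ) = hVec m h 0 := by
    ext k
    rw [Matrix.mulVec_single_one, Matrix.col_apply, Hmat, Matrix.of_apply,
      if_pos (by simp only [center]; omega)]
    congr 1
    simp only [center]
    push_cast
    ring
  rw [h1, Matrix.mulVec_smul, Matrix.mulVec_add, Matrix.mulVec_smul, h2, Gmat,
    Matrix.mulVec_mulVec, Matrix.mulVec_mulVec, Matrix.mul_assoc]

/-- With `b = w + T(1 - a)` the two residuals are `-b` and `2v - b`, and `|b|² - |2v - b|² = 4(v·b -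
|v|²)`. -/
theorem distDiff_flip (m : ℕ) {ℓ : ℕ} (h : Fin (ℓ + 1) → ℝ) (a : Fin (2 * (m + ℓ) + 1) → ℝ)
    (w : Fin (2 * m + ℓ + 1) → ℝ) (σ : Fin 2) (s : Fin (2 * m) → Fin 2)
    {v : Fin (2 * m + ℓ + 1) → ℝ}
    (hv : v = (Gmat m h a *ᵥ fun j => Smat m j s) +
      (((σ : ℕ) : ℝ) * a (center m ℓ)) • hVec m h 0) :
    1 / 4 * distDiff m h ((Hmat m h + Tmat m h) *ᵥ a - w) a (flip m ℓ a σ s) =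
      v ⬝ᵥ w + v ⬝ᵥ (Tmat m h *ᵥ (1 - a)) - v ⬝ᵥ v := by
  have e1 : (Hmat m h + Tmat m h) *ᵥ a - w - Tmat m h *ᵥ 1 - Hmat m h *ᵥ a =
      -(w + Tmat m h *ᵥ (1 - a)) := by
    rw [Matrix.add_mulVec, Matrix.mulVec_sub]; abel
  have e2 : (Hmat m h + Tmat m h) *ᵥ a - w - Tmat m h *ᵥ 1 - Hmat m h *ᵥ flip m ℓ a σ s =
      (2 : ℝ) • v - (w + Tmat m h *ᵥ (1 - a)) := by
    rw [hv, ← Hmat_mulVec_sub_flip, Matrix.add_mulVec, Matrix.mulVec_sub, Matrix.mulVec_sub]; abel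
  rw [distDiff, e1, e2]
  simp only [sqNorm, dotProduct_sub, sub_dotProduct, dotProduct_add, add_dotProduct,
    neg_dotProduct, dotProduct_neg, smul_dotProduct, dotProduct_smul, smul_eq_mul]
  rw [dotProduct_comm w v, dotProduct_comm (Tmat m h *ᵥ (1 - a)) v]
  ring

theorem vecMax_eq_iSup {ι : Type*} [Fintype ι] [Nonempty ι] (v : ι → ℝ) :
    vecMax v = ⨆ i, v i :=
  Finset.sup'_univ_eq_ciSup v

theorem vecMax_add_const {ι : Type*} [Fintype ι] [Nonempty ι] (v : ι → ℝ) (c : ℝ) :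
    vecMax (fun i => v i + c) = vecMax v + c := by
  rw [vecMax_eq_iSup, vecMax_eq_iSup]
  exact (ciSup_add (Set.finite_range v).bddAbove c).symm

/-- The flips with fixed `σ` exhaust the candidates with the prescribed central sign. The predicate
`p` covers both constraints: equality for `σ = 0`, inequality for `σ = 1`. -/
theorem iSup_candidates {m ℓ : ℕ} {a : Fin (2 * (m + ℓ) + 1) → ℝ}
    (ha : ∀ p, a p = -1 ∨ a p = 1) (σ : Fin 2) {p : (Fin (2 * (m + ℓ) + 1) → ℝ) → Prop}
    (hp : ∀ c ∈ candidates m ℓ,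
      p c ↔ (1 - 2 * ((σ : ℕ) : ℝ)) * a (center m ℓ) = c (center m ℓ))
    (f : (Fin (2 * (m + ℓ) + 1) → ℝ) → ℝ) :
    (⨆ c : {c : Fin (2 * (m + ℓ) + 1) → ℝ // c ∈ candidates m ℓ ∧ p c}, f c.1) =
      vecMax fun s => f (flip m ℓ a σ s) := by
  let g : (Fin (2 * m) → Fin 2) → {c : Fin (2 * (m + ℓ) + 1) → ℝ // c ∈ candidates m ℓ ∧ p c} :=
    fun s => ⟨flip m ℓ a σ s, flip_mem_candidates ha σ s,
      (hp _ (flip_mem_candidates ha σ s)).mpr (flip_center m ℓ a σ s).symm⟩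
  have hg : Function.Surjective g := by
    rintro ⟨c, hc, hpc⟩
    obtain ⟨s, hs⟩ := exists_flip_eq ha hc σ ((hp c hc).mp hpc)
    exact ⟨s, Subtype.ext hs⟩
  rw [vecMax_eq_iSup]
  exact (hg.iSup_comp (fun c => f c.1)).symm

theorem symbolWindow_center {Ω : Type*} (m ℓ : ℕ) (A : ℤ → Ω → ℝ) (t : ℤ) (ω : Ω) :
    symbolWindow m ℓ A t ω (center m ℓ) = A t ω := by
  simp only [symbolWindow, center]
  congr 1
  push_cast
  ring

theorem Smat_transpose_mulVec_apply {m : ℕ} {κ : Type*} [Fintype κ] (G : Matrix κ (Fin (2 * m)) ℝ)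
    (w : κ → ℝ) (s : Fin (2 * m) → Fin 2) :
    ((Smat m)ᵀ *ᵥ (Gᵀ *ᵥ w)) s = (G *ᵥ fun j => Smat m j s) ⬝ᵥ w := by
  rw [mulVec_dotProduct]
  rfl

theorem muVec_apply (m : ℕ) {ℓ : ℕ} (h : Fin (ℓ + 1) → ℝ) (a : Fin (2 * (m + ℓ) + 1) → ℝ)
    (s : Fin (2 * m) → Fin 2) :
    muVec m h a s = (Gmat m h a *ᵥ fun j => Smat m j s) ⬝ᵥ (Tmat m h *ᵥ (1 - a)) -
      sqNorm (Gmat m h a *ᵥ fun j => Smat m j s) := by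
  rw [muVec, Pi.sub_apply, Matrix.transpose_mul, ← Matrix.mulVec_mulVec,
    Smat_transpose_mulVec_apply]

theorem nuVec_apply (m : ℕ) {ℓ : ℕ} (h : Fin (ℓ + 1) → ℝ) (a : Fin (2 * (m + ℓ) + 1) → ℝ)
    (s : Fin (2 * m) → Fin 2) :
    nuVec m h a s = muVec m h a s -
      2 * a (center m ℓ) * (hVec m h 0 ⬝ᵥ (Gmat m h a *ᵥ fun j => Smat m j s)) := by
  rw [nuVec, Pi.sub_apply, Pi.smul_apply, smul_eq_mul, ← Matrix.vecMul_vecMul,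
    Matrix.dotProduct_mulVec]
  rfl

variable {Ω : Type*} (m : ℕ) {ℓ : ℕ} (h : Fin (ℓ + 1) → ℝ) {A : ℤ → Ω → ℝ} (W : ℤ → Ω → ℝ)
  (t : ℤ) {ω : Ω}

theorem Yvar_eq (hA : ∀ s, A s ω = -1 ∨ A s ω = 1) :
    Yvar m h A W t ω = vecMax ((Smat m)ᵀ *ᵥ ((Gmat m h (symbolWindow m ℓ A t ω))ᵀ *ᵥ
      outputWindow m ℓ W t ω) + muVec m h (symbolWindow m ℓ A t ω)) := by
  have ha : ∀ p, symbolWindow m ℓ A t ω p = -1 ∨ symbolWindow m ℓ A t ω p = 1 := fun p => hA _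
  rw [Yvar, outputWindow_channelOutput, ← symbolWindow_center m ℓ A t ω,
    iSup_candidates ha 0 (p := fun c => c (center m ℓ) = symbolWindow m ℓ A t ω (center m ℓ))
      (fun c _ => by simp [eq_comm])
      (fun c => 1 / 4 * distDiff m h ((Hmat m h + Tmat m h) *ᵥ symbolWindow m ℓ A t ω -
        outputWindow m ℓ W t ω) (symbolWindow m ℓ A t ω) c)]
  congr 1
  ext s
  rw [distDiff_flip _ _ _ _ _ _ rfl, Pi.add_apply, Smat_transpose_mulVec_apply, muVec_apply]
  simp [sqNorm]
  ring

/-- Here `v = G s + a₀ h₀`. The cross term of `|v|²` turns `μ` into `ν`; the terms free of `s` leave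
the maximum, with `a₀² = 1`. -/
theorem Xvar_eq (hA : ∀ s, A s ω = -1 ∨ A s ω = 1) :
    Xvar m h A W t ω = vecMax ((Smat m)ᵀ *ᵥ ((Gmat m h (symbolWindow m ℓ A t ω))ᵀ *ᵥ
      outputWindow m ℓ W t ω) + nuVec m h (symbolWindow m ℓ A t ω)) +
      (A t ω * (hVec m h 0 ⬝ᵥ outputWindow m ℓ W t ω) +
        A t ω * ((Tmat m h *ᵥ (1 - symbolWindow m ℓ A t ω)) ⬝ᵥ hVec m h 0) -
        sqNorm (hVec m h 0)) := by
  have ha : ∀ p, symbolWindow m ℓ A t ω p = -1 ∨ symbolWindow m ℓ A t ω p = 1 := fun p => hA _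
  rw [Xvar, outputWindow_channelOutput, ← symbolWindow_center m ℓ A t ω,
    iSup_candidates ha 1 (p := fun c => c (center m ℓ) ≠ symbolWindow m ℓ A t ω (center m ℓ))
      (fun c hc => by
        rcases ha (center m ℓ) with e | e <;> rcases hc.1 (center m ℓ) with e' | e' <;>
          rw [e, e'] <;> norm_num)
      (fun c => 1 / 4 * distDiff m h ((Hmat m h + Tmat m h) *ᵥ symbolWindow m ℓ A t ω -
        outputWindow m ℓ W t ω) (symbolWindow m ℓ A t ω) c), ← vecMax_add_const]
  congr 1
  ext s
  rw [distDiff_flip _ _ _ _ _ _ rfl, Pi.add_apply, Smat_transpose_mulVec_apply, nuVec_apply,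
    muVec_apply]
  have hsq : symbolWindow m ℓ A t ω (center m ℓ) * symbolWindow m ℓ A t ω (center m ℓ) = 1 := by
    rcases ha (center m ℓ) with e | e <;> rw [e] <;> norm_num
  generalize symbolWindow m ℓ A t ω (center m ℓ) = x at hsq
  simp only [sqNorm, dotProduct_add, add_dotProduct, smul_dotProduct, dotProduct_smul, smul_eq_mul,
    Fin.val_one, Nat.cast_one, one_mul]
  rw [dotProduct_comm (Gmat m h _ *ᵥ _) (hVec m h 0), dotProduct_comm (Tmat m h *ᵥ _) (hVec m h 0)]
  linear_combination (-(hVec m h 0 ⬝ᵥ hVec m h 0)) * hsq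

end Channel

/-! ### Conditioning on `U` and the distribution function of `V`. -/

section DistributionFunction

open WithLp

theorem measureReal_prod_eq_integral {α β : Type*} [MeasurableSpace α] [MeasurableSpace β]
    (μ : Measure α) (ν : Measure β) [IsFiniteMeasure ν] {s : Set (α × β)} (hs : MeasurableSet s) :
    (μ.prod ν).real s = ∫ x, ν.real (Prod.mk x ⁻¹' s) ∂μ := by
  rw [measureReal_def, Measure.prod_apply hs]
  exact (integral_toReal (measurable_measure_prodMk_left hs).aemeasurable
    (Filter.Eventually.of_forall fun x => measure_lt_top _ _)).symm

/-- By independence the joint law is a product, so the probability is the mean of the section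
probabilities, which `h` supplies as integrals over the auxiliary variable `u`. -/
theorem measureReal_preimage_prodMk_eq_integral {Ω α β γ : Type*} [MeasurableSpace Ω]
    [MeasurableSpace α] [MeasurableSpace β] [MeasurableSpace γ] {P : Measure Ω} [IsFiniteMeasure P]
    {μ : Measure γ} [SFinite μ] {ν : Measure β} [IsFiniteMeasure ν] {X : Ω → α} {Y : Ω → β}
    (hX : Measurable X) (hY : AEMeasurable Y P) (hXY : IndepFun X Y P) (hν : P.map Y = ν)
    {S : Set (α × β)} (hS : MeasurableSet S) {f : Ω × γ → ℝ} (hf : Integrable f (P.prod μ))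
    (h : ∀ ω, ∫ u, f (ω, u) ∂μ = ν.real (Prod.mk (X ω) ⁻¹' S)) :
    P.real ((fun ω => (X ω, Y ω)) ⁻¹' S) = ∫ x, f x ∂(P.prod μ) := by
  rw [integral_prod _ hf, measureReal_def,
    ← Measure.map_apply_of_aemeasurable (hX.aemeasurable.prodMk hY) hS,
    hXY.map_prod_eq_prod_map_map hX.aemeasurable hY, hν, ← measureReal_def,
    measureReal_prod_eq_integral _ _ hS]
  simp_rw [h]
  exact integral_map hX.aemeasurable
    (measurable_measure_prodMk_left hS).ennreal_toReal.aestronglyMeasurable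

theorem measurable_vecMax {α ι : Type*} [MeasurableSpace α] [Fintype ι] [Nonempty ι]
    {f : α → ι → ℝ} (hf : ∀ i, Measurable fun x => f x i) : Measurable fun x => vecMax (f x) := by
  have h := Finset.measurable_sup' (Finset.univ_nonempty (α := ι))
    (f := fun i x => f x i) fun i _ => hf i
  convert h using 1
  ext x
  rw [vecMax, Finset.sup'_apply]

theorem measurable_gaussianCDF {n : ℕ} (K : Matrix (Fin n) (Fin n) ℝ) :
    Measurable (gaussianCDF K) := by
  have hs : MeasurableSet {y : (Fin n → ℝ) × EuclideanSpace ℝ (Fin n) | ∀ i, y.2 i ≤ y.1 i} := by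
    rw [Set.ofPred_forall]
    exact MeasurableSet.iInter fun i => measurableSet_le (by fun_prop) (by fun_prop)
  exact (measurable_measure_prodMk_left (ν := multivariateGaussian 0 K) hs).ennreal_toReal

variable (m : ℕ) {ℓ n : ℕ} (h : Fin (ℓ + 1) → ℝ)
  (K : Matrix (Fin n × Fin (2 * m + ℓ + 1)) (Fin n × Fin (2 * m + ℓ + 1)) ℝ)
  (a : Fin n → Fin (2 * (m + ℓ) + 1) → ℝ)
  (Q : Matrix (Fin n × Fin (2 * m)) (Fin n × Fin (2 * m)) ℝ)
  (d : Fin n × Fin (2 * m) → ℝ) (r : Fin n → ℝ)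

theorem measurable_integrand :
    Measurable fun u : EuclideanSpace ℝ (Fin n × Fin (2 * m)) =>
      integrand m h K a Q d r fun q => u q := by
  refine (measurable_gaussianCDF _).comp (measurable_pi_iff.mpr fun i => ?_)
  simp only [Pi.add_apply, Pi.sub_apply, deltaVec, etaVec]
  refine (measurable_const.add ((measurable_vecMax fun s => ?_).sub
    (measurable_vecMax fun s => ?_))).sub (measurable_const.add ?_) <;>
  · simp only [Pi.add_apply, Matrix.mulVec, dotProduct]
    fun_prop

theorem abs_integrand_le_one (u : Fin n × Fin (2 * m) → ℝ) :
    ‖integrand m h K a Q d r u‖ ≤ 1 := by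
  rw [integrand, gaussianCDF, Real.norm_of_nonneg measureReal_nonneg]
  exact measureReal_le_one

/-- The event `X - Y ≤ r`, in terms of `x = (diag(A_{t_1}, …, A_{t_n}) ⊗ h_0^T) W` and
`y = Γ^T W`. -/
def differenceEvent : Set (EuclideanSpace ℝ (Fin n ⊕ Fin n × Fin (2 * m))) :=
  {z | ∀ i, vecMax ((Smat m)ᵀ *ᵥ (fun j => z (Sum.inr (i, j))) + nuVec m h (a i)) +
    (z (Sum.inl i) + a i (center m ℓ) * ((Tmat m h *ᵥ (1 - a i)) ⬝ᵥ hVec m h 0) -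
      sqNorm (hVec m h 0)) -
    vecMax ((Smat m)ᵀ *ᵥ (fun j => z (Sum.inr (i, j))) + muVec m h (a i)) ≤ r i}

theorem measurableSet_differenceEvent : MeasurableSet (differenceEvent m h a r) := by
  rw [differenceEvent, Set.ofPred_forall]
  refine MeasurableSet.iInter fun i => measurableSet_le ?_ measurable_const
  refine ((measurable_vecMax fun s => ?_).add ?_).sub (measurable_vecMax fun s => ?_)
  · simp only [Pi.add_apply, Matrix.mulVec, dotProduct]
    fun_prop
  · fun_prop
  · simp only [Pi.add_apply, Matrix.mulVec, dotProduct]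
    fun_prop

/-- The pair `((diag(A_{t_1}, …, A_{t_n}) ⊗ h_0^T) w, Γ^T w)`. -/
noncomputable def noiseImage (w : EuclideanSpace ℝ (Fin n × Fin (2 * m + ℓ + 1))) :
    EuclideanSpace ℝ (Fin n ⊕ Fin n × Fin (2 * m)) :=
  toLp 2 (Sum.elim (diagKronH m h a *ᵥ ofLp w) ((Gamma m h a)ᵀ *ᵥ ofLp w))

theorem measurable_noiseImage : Measurable (noiseImage m h a) := by
  refine (WithLp.measurable_toLp 2 _).comp (measurable_pi_iff.mpr ?_)
  rintro (i | i) <;> simp only [Sum.elim_inl, Sum.elim_inr, Matrix.mulVec, dotProduct] <;>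
    fun_prop

theorem noiseImage_inl (w : EuclideanSpace ℝ (Fin n × Fin (2 * m + ℓ + 1))) (i : Fin n) :
    noiseImage m h a w (Sum.inl i) =
      a i (center m ℓ) * (hVec m h 0 ⬝ᵥ fun k => w (i, k)) := by
  simp [noiseImage, Matrix.mulVec, dotProduct, diagKronH, Fintype.sum_prod_type, ite_mul,
    Finset.mul_sum, mul_assoc]

theorem noiseImage_inr (w : EuclideanSpace ℝ (Fin n × Fin (2 * m + ℓ + 1))) (i : Fin n) :
    (fun j => noiseImage m h a w (Sum.inr (i, j))) = (Gmat m h (a i))ᵀ *ᵥ fun k => w (i, k) := by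
  ext j
  simp [noiseImage, Matrix.mulVec, dotProduct, Gamma, Fintype.sum_prod_type, ite_mul]

variable {m h K a Q d}

theorem IsFactorization.posSemidef_KV (hf : IsFactorization m h K a Q d) (hK : K.PosSemidef) :
    (KV m h K a Q d).PosSemidef :=
  posSemidef_conditional_covariance hK hf.decomposes
    (by simpa [Matrix.conjTranspose_eq_transpose_of_trivial] using (posDef_kronSS m n).1.eq)
    hf.diagonalizes (diagKronH m h a) rfl

theorem IsFactorization.map_noiseImage (hf : IsFactorization m h K a Q d) (hK : K.PosSemidef) :
    (multivariateGaussian 0 K).map (noiseImage m h a) =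
      ((stdGaussian (EuclideanSpace ℝ (Fin n × Fin (2 * m)))).prod
        (multivariateGaussian 0 (KV m h K a Q d))).map (fun x => toLp 2
          (Sum.elim (Fmat m h K a Q d *ᵥ ofLp x.1 + ofLp x.2)
            ((Q * Matrix.diagonal d) *ᵥ ofLp x.1))) := by
  refine map_multivariateGaussian_pair hK (hf.posSemidef_KV hK) _ _ _ _ ?_ ?_ ?_
  · rw [KV]; abel
  · exact (conditional_cross_covariance hK hf.decomposes
      (by simpa [Matrix.conjTranspose_eq_transpose_of_trivial] using (posDef_kronSS m n).1.eq)
      hf.diagonalizes _).symm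
  · rw [← hf.decomposes, sq, Matrix.transpose_mul, Matrix.diagonal_transpose]
    simp only [Matrix.mul_assoc]

/-- The theorem for fixed symbols: after replacing the noise pair by `(F U + V, Q Λ U)`, the section
of the event at `U = u` is `V ≤ r + δ - η`. -/
theorem IsFactorization.integral_integrand (hf : IsFactorization m h K a Q d)
    (hK : K.PosSemidef) :
    ∫ u, integrand m h K a Q d r (fun q => u q)
        ∂(stdGaussian (EuclideanSpace ℝ (Fin n × Fin (2 * m)))) =
      (multivariateGaussian 0 K).real (noiseImage m h a ⁻¹' differenceEvent m h a r) := by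
  have hE := measurableSet_differenceEvent m h a r
  have hmeas : Measurable (fun x : EuclideanSpace ℝ (Fin n × Fin (2 * m)) ×
      EuclideanSpace ℝ (Fin n) => toLp 2
          (Sum.elim (Fmat m h K a Q d *ᵥ ofLp x.1 + ofLp x.2)
            ((Q * Matrix.diagonal d) *ᵥ ofLp x.1))) := by
    refine (WithLp.measurable_toLp 2 _).comp (measurable_pi_iff.mpr ?_)
    rintro (i | i) <;> simp only [Sum.elim_inl, Sum.elim_inr, Matrix.mulVec, dotProduct,
      Pi.add_apply] <;> fun_prop
  rw [← map_measureReal_apply (measurable_noiseImage m h a) hE, hf.map_noiseImage hK,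
    map_measureReal_apply hmeas hE, measureReal_prod_eq_integral _ _ (hmeas hE)]
  refine integral_congr_ae (Filter.Eventually.of_forall fun u => ?_)
  simp only [integrand, gaussianCDF]
  congr 1
  ext v
  simp only [Set.mem_ofPred_eq, Set.mem_preimage, differenceEvent, Sum.elim_inl, Sum.elim_inr,
    Pi.add_apply, Pi.sub_apply, deltaVec, etaVec]
  refine forall_congr' fun i => ?_
  have e : ((Smat m)ᵀ * Qblock Q i * Matrix.diagonal d) *ᵥ (fun q => u q) =
      (Smat m)ᵀ *ᵥ fun j => ((Q * Matrix.diagonal d) *ᵥ ofLp u) (i, j) := by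
    rw [Matrix.mul_assoc, ← Matrix.mulVec_mulVec]
    rfl
  rw [e]
  constructor <;> intro hi <;> linarith

end DistributionFunction

/-! ### Existence of factorizations, finite encoding of the symbols, and the theorem. -/

theorem exists_isFactorization (m : ℕ) {ℓ n : ℕ} (h : Fin (ℓ + 1) → ℝ)
    {K : Matrix (Fin n × Fin (2 * m + ℓ + 1)) (Fin n × Fin (2 * m + ℓ + 1)) ℝ}
    (hK : K.PosSemidef) (a : Fin n → Fin (2 * (m + ℓ) + 1) → ℝ) :
    ∃ Q d, IsFactorization m h K a Q d := by
  have hM : ((Gamma m h a)ᵀ * K * Gamma m h a).PosSemidef := by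
    simpa [Matrix.conjTranspose_eq_transpose_of_trivial] using
      hK.conjTranspose_mul_mul_same (Gamma m h a)
  obtain ⟨Q, d, h1, h2, h3⟩ := exists_simultaneous_diagonalization hM (posDef_kronSS m n)
  exact ⟨Q, d, h1, h2, h3⟩

theorem forall_Xvar_sub_Yvar_le_iff {Ω : Type*} (m : ℕ) {ℓ n : ℕ} (h : Fin (ℓ + 1) → ℝ)
    {A : ℤ → Ω → ℝ} (W : ℤ → Ω → ℝ) (t : Fin n → ℤ) (r : Fin n → ℝ) {ω : Ω}
    (hA : ∀ s, A s ω = -1 ∨ A s ω = 1) :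
    (∀ i, Xvar m h A W (t i) ω - Yvar m h A W (t i) ω ≤ r i) ↔
      noiseImage m h (symbolBlock m ℓ A t ω)
          (WithLp.toLp 2 fun p => outputWindow m ℓ W (t p.1) ω p.2) ∈
        differenceEvent m h (symbolBlock m ℓ A t ω) r := by
  rw [differenceEvent, Set.mem_ofPred_eq]
  refine forall_congr' fun i => ?_
  rw [Xvar_eq m h W (t i) hA, Yvar_eq m h W (t i) hA, noiseImage_inl, noiseImage_inr]
  simp only [symbolBlock, symbolWindow_center]

/-- The real sign sequences encoded by Boolean sequences. -/
noncomputable def decodeSigns {n N : ℕ} (b : Fin n → Fin N → Bool) : Fin n → Fin N → ℝ :=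
  fun i p => if b i p then 1 else -1

/-- The Boolean encoding of the symbol neighborhoods of a sequence of symbols. -/
noncomputable def encodeSymbols (m ℓ : ℕ) {n : ℕ} (t : Fin n → ℤ) (x : ℤ → ℝ) :
    Fin n → Fin (2 * (m + ℓ) + 1) → Bool :=
  fun i p => if x (t i - (m : ℤ) - (ℓ : ℤ) + ((p : ℕ) : ℤ)) = 1 then true else false

theorem measurable_encodeSymbols (m ℓ : ℕ) {n : ℕ} (t : Fin n → ℤ) :
    Measurable (encodeSymbols m ℓ t) := by
  refine measurable_pi_iff.mpr fun i => measurable_pi_iff.mpr fun p => ?_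
  exact Measurable.ite (measurableSet_eq_fun (by fun_prop) measurable_const)
    measurable_const measurable_const

theorem decodeSigns_encodeSymbols {Ω : Type*} (m ℓ : ℕ) {n : ℕ} {A : ℤ → Ω → ℝ} (t : Fin n → ℤ)
    {ω : Ω} (hA : ∀ s, A s ω = -1 ∨ A s ω = 1) :
    decodeSigns (encodeSymbols m ℓ t fun s => A s ω) = symbolBlock m ℓ A t ω := by
  ext i p
  simp only [decodeSigns, encodeSymbols, symbolBlock, symbolWindow]
  rcases hA (t i - (m : ℤ) - (ℓ : ℤ) + ((p : ℕ) : ℤ)) with e | e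
  · simp only [e]
    norm_num
  · simp [e]

end MLM

/-- The expectation over `A` and an independent standard Gaussian vector `U` of length `2mn` is the
integral with respect to the product of `P` and the standard Gaussian measure. `Q` and `d` (with
`Λ = diag(d)`) are arbitrary admissible choices, as functions of the transmitted symbols. -/
theorem theorem1 {Ω : Type*} [MeasurableSpace Ω] (P : Measure Ω) [IsProbabilityMeasure P]
    (m ℓ n : ℕ) (h : Fin (ℓ + 1) → ℝ) (A W : ℤ → Ω → ℝ)
    (hA_meas : ∀ s, Measurable (A s))
    (hA_sign : ∀ s ω, A s ω = -1 ∨ A s ω = 1)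
    (hW_gauss : IsGaussianProcess W P)
    (hW_mean : ∀ s, ∫ ω, W s ω ∂P = 0)
    (hAW : IndepFun (fun ω s => A s ω) (fun ω s => W s ω) P)
    (t : Fin n → ℤ) :
    (∀ a : Fin n → Fin (2 * (m + ℓ) + 1) → ℝ, (∀ i p, a i p = -1 ∨ a i p = 1) →
      ∃ Q d, MLM.IsFactorization m h (MLM.noiseCov P m ℓ W t) a Q d) ∧
    ∀ (Q : (Fin n → Fin (2 * (m + ℓ) + 1) → ℝ) →
          Matrix (Fin n × Fin (2 * m)) (Fin n × Fin (2 * m)) ℝ)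
      (d : (Fin n → Fin (2 * (m + ℓ) + 1) → ℝ) → Fin n × Fin (2 * m) → ℝ),
      (∀ ω, MLM.IsFactorization m h (MLM.noiseCov P m ℓ W t) (MLM.symbolBlock m ℓ A t ω)
        (Q (MLM.symbolBlock m ℓ A t ω)) (d (MLM.symbolBlock m ℓ A t ω))) →
      (∀ ω, (MLM.KV m h (MLM.noiseCov P m ℓ W t) (MLM.symbolBlock m ℓ A t ω)
        (Q (MLM.symbolBlock m ℓ A t ω)) (d (MLM.symbolBlock m ℓ A t ω))).PosSemidef) ∧
      ∀ r : Fin n → ℝ,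
        Integrable (fun x : Ω × EuclideanSpace ℝ (Fin n × Fin (2 * m)) =>
          MLM.integrand m h (MLM.noiseCov P m ℓ W t) (MLM.symbolBlock m ℓ A t x.1)
            (Q (MLM.symbolBlock m ℓ A t x.1)) (d (MLM.symbolBlock m ℓ A t x.1)) r (fun q => x.2 q))
          (P.prod (stdGaussian (EuclideanSpace ℝ (Fin n × Fin (2 * m))))) ∧
        P.real {ω | ∀ i, MLM.Xvar m h A W (t i) ω - MLM.Yvar m h A W (t i) ω ≤ r i} =
          ∫ x : Ω × EuclideanSpace ℝ (Fin n × Fin (2 * m)),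
            MLM.integrand m h (MLM.noiseCov P m ℓ W t) (MLM.symbolBlock m ℓ A t x.1)
              (Q (MLM.symbolBlock m ℓ A t x.1)) (d (MLM.symbolBlock m ℓ A t x.1)) r
              (fun q => x.2 q)
            ∂(P.prod (stdGaussian (EuclideanSpace ℝ (Fin n × Fin (2 * m))))) := by
  have hA : ∀ ω s, A s ω = -1 ∨ A s ω = 1 := fun ω s => hA_sign s ω
  obtain ⟨hK, hlaw⟩ := MLM.map_gaussianProcess hW_gauss hW_mean
    fun p : Fin n × Fin (2 * m + ℓ + 1) => t p.1 - (m : ℤ) + ((p.2 : ℕ) : ℤ)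
  change (MLM.noiseCov P m ℓ W t).PosSemidef at hK
  change P.map (fun ω => WithLp.toLp 2
    fun p : Fin n × Fin (2 * m + ℓ + 1) => MLM.outputWindow m ℓ W (t p.1) ω p.2) =
      multivariateGaussian 0 (MLM.noiseCov P m ℓ W t) at hlaw
  set K := MLM.noiseCov P m ℓ W t with hKdef
  refine ⟨fun a _ => MLM.exists_isFactorization m h hK a, fun Q d hQ =>
    ⟨fun ω => (hQ ω).posSemidef_KV hK, fun r => ?_⟩⟩
  set γ := stdGaussian (EuclideanSpace ℝ (Fin n × Fin (2 * m)))
  -- `Q` and `d` are arbitrary functions of the symbols. Passing through a finite discrete type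
  -- makes their dependence on the symbols measurable.
  set b : Ω → Fin n → Fin (2 * (m + ℓ) + 1) → Bool :=
    fun ω => MLM.encodeSymbols m ℓ t fun s => A s ω with hb
  have hbm : Measurable b :=
    (MLM.measurable_encodeSymbols m ℓ t).comp (measurable_pi_iff.mpr hA_meas)
  have hdec : ∀ ω, MLM.decodeSigns (b ω) = MLM.symbolBlock m ℓ A t ω := fun ω =>
    MLM.decodeSigns_encodeSymbols m ℓ t (hA ω)
  have hmeas : Measurable fun x : Ω × EuclideanSpace ℝ (Fin n × Fin (2 * m)) =>
      MLM.integrand m h K (MLM.symbolBlock m ℓ A t x.1) (Q (MLM.symbolBlock m ℓ A t x.1))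
        (d (MLM.symbolBlock m ℓ A t x.1)) r (fun q => x.2 q) := by
    have h1 : Measurable fun y : (Fin n → Fin (2 * (m + ℓ) + 1) → Bool) ×
        EuclideanSpace ℝ (Fin n × Fin (2 * m)) =>
        MLM.integrand m h K (MLM.decodeSigns y.1) (Q (MLM.decodeSigns y.1))
          (d (MLM.decodeSigns y.1)) r (fun q => y.2 q) :=
      -- The first factor is countable, so measurability is checked for each fixed symbol pattern.
      measurable_from_prod_countable_right fun c => by
        exact MLM.measurable_integrand m h K (MLM.decodeSigns c) (Q (MLM.decodeSigns c))
          (d (MLM.decodeSigns c)) r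
    have h2 := h1.comp ((hbm.comp measurable_fst).prodMk
      (measurable_snd (α := Ω) (β := EuclideanSpace ℝ (Fin n × Fin (2 * m)))))
    simpa only [Function.comp_def, hdec] using h2
  have hint : Integrable (fun x : Ω × EuclideanSpace ℝ (Fin n × Fin (2 * m)) =>
      MLM.integrand m h K (MLM.symbolBlock m ℓ A t x.1) (Q (MLM.symbolBlock m ℓ A t x.1))
        (d (MLM.symbolBlock m ℓ A t x.1)) r (fun q => x.2 q)) (P.prod γ) :=
    Integrable.of_bound hmeas.aestronglyMeasurable 1
      (Filter.Eventually.of_forall fun x => MLM.abs_integrand_le_one m h K _ _ _ r _)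
  refine ⟨hint, ?_⟩
  set w : Ω → EuclideanSpace ℝ (Fin n × Fin (2 * m + ℓ + 1)) :=
    fun ω => WithLp.toLp 2 fun p => MLM.outputWindow m ℓ W (t p.1) ω p.2 with hw
  have hwm : AEMeasurable w P := (WithLp.measurable_toLp 2 _).comp_aemeasurable
    (aemeasurable_pi_lambda _ fun p => hW_gauss.aemeasurable _)
  have hind : IndepFun b w P := by
    refine hAW.comp (φ := MLM.encodeSymbols m ℓ t)
      (ψ := fun y : ℤ → ℝ => (WithLp.toLp 2 fun p : Fin n × Fin (2 * m + ℓ + 1) =>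
        y (t p.1 - (m : ℤ) + ((p.2 : ℕ) : ℤ)) : EuclideanSpace ℝ (Fin n × Fin (2 * m + ℓ + 1))))
      (MLM.measurable_encodeSymbols m ℓ t) ?_
    exact (WithLp.measurable_toLp 2 _).comp (measurable_pi_iff.mpr fun p => by fun_prop)
  set S : Set ((Fin n → Fin (2 * (m + ℓ) + 1) → Bool) ×
      EuclideanSpace ℝ (Fin n × Fin (2 * m + ℓ + 1))) :=
    {y | MLM.noiseImage m h (MLM.decodeSigns y.1) y.2 ∈
      MLM.differenceEvent m h (MLM.decodeSigns y.1) r} with hS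
  have hSm : MeasurableSet S := by
    refine measurableSet_setOfPred.mpr (measurable_from_prod_countable_right fun c => ?_)
    have hc : MeasurableSet (MLM.noiseImage m h (MLM.decodeSigns c) ⁻¹'
        MLM.differenceEvent m h (MLM.decodeSigns c) r) :=
      MLM.measurable_noiseImage m h (MLM.decodeSigns c)
        (MLM.measurableSet_differenceEvent m h (MLM.decodeSigns c) r)
    exact measurableSet_setOfPred.mp hc
  have hevent : {ω | ∀ i, MLM.Xvar m h A W (t i) ω - MLM.Yvar m h A W (t i) ω ≤ r i} =
      (fun ω => (b ω, w ω)) ⁻¹' S := by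
    ext ω
    rw [Set.mem_ofPred_eq, MLM.forall_Xvar_sub_Yvar_le_iff m h W t r (hA ω)]
    simp only [hS, Set.mem_preimage, Set.mem_ofPred_eq, hdec, hw]
  rw [hevent]
  -- What remains is the fixed-symbol identity at the realization `A(ω)`.
  refine MLM.measureReal_preimage_prodMk_eq_integral hbm hwm hind hlaw hSm hint fun ω => ?_
  refine ((hQ ω).integral_integrand r hK).trans ?_
  rw [← hdec]
  rfl
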